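/- Let $H^2\subset L^2(\partial\mathbb D)$ be the Hardy space (normalized arc length). For an inner function $\alpha$ let $K_\alpha=H^2\ominus\alpha H^2$, let $P_\alpha$ be the orthogonal projection of $L^2(\partial\mathbb D)$ onto $K_\alpha$, and let $\mathcal T(\alpha,\beta)$ be the set of bounded operators $A:K_\alpha\to K_\beta$ of the form $Af=P_\beta(\varphi f)$ with a symbol $\varphi\in L^2(\partial\mathbb D)$. Let $\alpha$ and $\beta$ be finite Blaschke products of degrees $m>0$ and $n>0$, that is, $\alpha(z)=c\prod_{i=1}^m\frac{a_i-z}{1-\overline{a_i}z}$ with $|c|=1$ and $|a_i|<1$ (the $a_i$ not necessarily distinct), and similarly for $\beta$. Let $\lambda_1,\lambda_2\in\partial\mathbb D$, let $\eta_1,\dots,\eta_m\in\partial\mathbb D$ be the $m$ distinct solutions of $\alpha(\eta)=\frac{\lambda_1+\alpha(0)}{1+\overline{\alpha(0)}\lambda_1}$ and let $\zeta_1,\dots,\zeta_n\in\partial\mathbb D$ be the $n$ distinct solutions of $\beta(\zeta)=\frac{\lambda_2+\beta(0)}{1+\overline{\beta(0)}\lambda_2}$. Assume that $\{\eta_1,\dots,\eta_m\}$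 and $\{\zeta_1,\dots,\zeta_n\}$ have precisely $l$ elements in common ($0\le l\le\min(m,n)$), numbered so that $\eta_j=\zeta_j$ for $j\le l$. With $k^\alpha_\eta(z)=\frac{1-\overline{\alpha(\eta)}\alpha(z)}{1-\overline\eta z}$, the functions $v^\alpha_{\eta_p}=\|k^\alpha_{\eta_p}\|^{-1}k^\alpha_{\eta_p}$ $(1\le p\le m)$ form an orthonormal basis of $K_\alpha$, and the functions $v^\beta_{\zeta_s}=\|k^\beta_{\zeta_s}\|^{-1}k^\beta_{\zeta_s}$ $(1\le s\le n)$ form an orthonormal basis of $K_\beta$ (the Clark bases). Let $A:K_\alpha\to K_\beta$ be any linear transformation and let $(r_{s,p})$ be its matrix with respect to these bases, $Av^\alpha_{\eta_p}=\sum_s r_{s,p}v^\beta_{\zeta_s}$. (a) If $l=0$, then $A\in\mathcal T(\alpha,\beta)$ if and only if, for all $1\le p\le m$ and $1\le s\le n$, $$r_{s,p}=\frac{\sqrt{|\alpha'(\eta_1)|}}{\sqrt{|\alpha'(\eta_p)|}}\frac{\eta_p}{\eta_1}\frac{\eta_1-\zeta_s}{\eta_p-\zeta_s}r_{s,1}+\frac{\sqrt{|\alpha'(\eta_1)|}\sqrt{|\beta'(\zeta_1)|}}{\sqrt{|\alpha'(\eta_p)|}\sqrt{|\beta'(\zeta_s)|}}\frac{\eta_p}{\eta_1}\frac{\zeta_1-\eta_1}{\eta_p-\zeta_s}r_{1,1}+\frac{\sqrt{|\beta'(\zeta_1)|}}{\sqrt{|\beta'(\zeta_s)|}}\frac{\eta_p-\zeta_1}{\eta_p-\zeta_s}r_{1,p}.$$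 (b) If $l>0$, then $A\in\mathcal T(\alpha,\beta)$ if and only if $$r_{s,p}=\frac{\sqrt{|\alpha'(\eta_s)|}\sqrt{|\beta'(\zeta_1)|}}{\sqrt{|\alpha'(\eta_p)|}\sqrt{|\beta'(\zeta_s)|}}\frac{\eta_p}{\eta_s}\frac{\eta_1-\zeta_s}{\eta_p-\zeta_s}r_{1,s}+\frac{\sqrt{|\beta'(\zeta_1)|}}{\sqrt{|\beta'(\zeta_s)|}}\frac{\eta_p-\zeta_1}{\eta_p-\zeta_s}r_{1,p}$$ for all $1\le p\le m$, $1\le s\le l$, $s\ne p$, and $$r_{s,p}=\frac{\sqrt{|\alpha'(\eta_1)|}}{\sqrt{|\alpha'(\eta_p)|}}\frac{\eta_p}{\eta_1}\frac{\eta_1-\zeta_s}{\eta_p-\zeta_s}r_{s,1}+\frac{\sqrt{|\beta'(\zeta_1)|}}{\sqrt{|\beta'(\zeta_s)|}}\frac{\eta_p-\zeta_1}{\eta_p-\zeta_s}r_{1,p}$$ for all $1\le p\le m$, $l<s\le n$. Moreover, $A\in\mathcal T(\alpha,\beta)$ is determined by $m+n-1$ entries of its matrix, which may be prescribed arbitrarily: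 let $E$ be the set of positions of the first row and the first column if $l=0$, and the set of positions of the first row, of the diagonal entries $r_{s,s}$ with $s\le l$, and of the entries $r_{s,1}$ with $s>l$ if $l>0$. Then $E$ has $m+n-1$ elements, and for any complex numbers $x_{s,p}$, $(s,p)\in E$, there is exactly one $A\in\mathcal T(\alpha,\beta)$ with $r_{s,p}=x_{s,p}$ for all $(s,p)\in E$. -/

import Mathlib

open MeasureTheory

/-! Functions on the unit circle `∂𝔻` are written as functions of `t ∈ ℝ/ℤ` through the
parametrization `t ↦ e^{2πit}` (`AddCircle.toCircle`); the measure is normalized arc length. -/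

noncomputable section

/-- The point `e^{2πit}` of the unit circle, as a complex number. -/
def circlePt (t : UnitAddCircle) : ℂ := (AddCircle.toCircle t : ℂ)

/-- `L²(∂𝔻)` with respect to normalized arc length. -/
abbrev L2Circle : Type :=
  Lp ℂ 2 (AddCircle.haarAddCircle : Measure UnitAddCircle)

/-- The Hardy space `H²`, as the subspace of `L²(∂𝔻)` of all functions whose Fourier
coefficients of negative index vanish. -/
def hardySpace : Submodule ℂ L2Circle where
  carrier := {f | ∀ n : ℤ, n < 0 → fourierCoeff f n = 0}
  zero_mem' := by
    intro n _
    rw [← fourierBasis_repr]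
    simp
  add_mem' := by
    intro f g hf hg n hn
    have h1 := hf n hn
    have h2 := hg n hn
    rw [← fourierBasis_repr] at h1 h2 ⊢
    simp [h1, h2]
  smul_mem' := by
    intro c f hf n hn
    have h1 := hf n hn
    rw [← fourierBasis_repr] at h1 ⊢
    simp [h1]

/-- `α H²`: all `g ∈ L²(∂𝔻)` that agree almost everywhere on the circle with `α h` for some
`h ∈ H²`. -/
def mulHardySpace (α : ℂ → ℂ) : Submodule ℂ L2Circle where
  carrier := {g | ∃ h ∈ hardySpace,
    (g : UnitAddCircle → ℂ) =ᵐ[AddCircle.haarAddCircle] fun t => α (circlePt t) * h t}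
  zero_mem' := by
    refine ⟨0, hardySpace.zero_mem, ?_⟩
    filter_upwards with t
    simp
  add_mem' := by
    rintro f g ⟨u, hu, hfu⟩ ⟨v, hv, hgv⟩
    refine ⟨u + v, hardySpace.add_mem hu hv, ?_⟩
    filter_upwards [hfu, hgv, Lp.coeFn_add f g, Lp.coeFn_add u v] with t h1 h2 h3 h4
    simp only [h3, h4, Pi.add_apply, h1, h2]
    ring
  smul_mem' := by
    rintro c f ⟨u, hu, hfu⟩
    refine ⟨c • u, hardySpace.smul_mem c hu, ?_⟩
    filter_upwards [hfu, Lp.coeFn_smul c f, Lp.coeFn_smul c u] with t h1 h2 h3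
    simp only [h2, h3, Pi.smul_apply, h1, smul_eq_mul]
    ring

/-- The model space `K_α = H² ⊖ α H²`. -/
def modelSpace (α : ℂ → ℂ) : Submodule ℂ L2Circle :=
  hardySpace ⊓ (mulHardySpace α)ᗮ

theorem isClosed_hardySpace : IsClosed (hardySpace : Set L2Circle) := by
  have h : (hardySpace : Set L2Circle) =
      ⋂ n : ℤ, ⋂ _ : n < 0, {f | inner ℂ (fourierLp 2 n : L2Circle) f = 0} := by
    ext f
    simp only [Set.mem_iInter, Set.mem_ofPred_eq]
    refine forall_congr' fun n => forall_congr' fun _ => ?_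
    rw [← fourierBasis_repr, HilbertBasis.repr_apply_apply, coe_fourierBasis]
  rw [h]
  exact isClosed_iInter fun n => isClosed_iInter fun _ =>
    isClosed_eq (by fun_prop) continuous_const

theorem isClosed_modelSpace (α : ℂ → ℂ) : IsClosed (modelSpace α : Set L2Circle) :=
  isClosed_hardySpace.inter (Submodule.isClosed_orthogonal _)

instance (α : ℂ → ℂ) : CompleteSpace (modelSpace α) :=
  (isClosed_modelSpace α).completeSpace_coe

/-- `𝒯(α, β)`: the bounded linear `A : K_α → K_β` such that, for some symbol `φ ∈ L²(∂𝔻)`,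
`A f = P_β (φ f)` for every `f ∈ K_α` in the domain of `f ↦ P_β (φ f)`, that is, with
`φ f ∈ L²(∂𝔻)`. This domain contains all bounded functions of `K_α`, so it is dense in `K_α`, and
it is all of `K_α` if `α` is a finite Blaschke product. `P_β` is the orthogonal projection of
`L²(∂𝔻)` onto `K_β`. -/
def asymTruncToeplitz (α β : ℂ → ℂ) : Set (modelSpace α →ₗ[ℂ] modelSpace β) :=
  {A | Continuous A ∧ ∃ φ : L2Circle, ∀ (f : modelSpace α)
    (h : MemLp (fun t : UnitAddCircle => φ t * (f : L2Circle) t) 2 AddCircle.haarAddCircle),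
      A f = (modelSpace β).orthogonalProjectionOnto (h.toLp _)}

/-- `α` is a finite Blaschke product of degree `m`: for a unimodular constant `c` and (not
necessarily distinct) zeros `a₁, …, a_m` in the open unit disk,
`α(z) = c ∏ (a_i - z) / (1 - \bar{a_i} z)`. -/
def IsFiniteBlaschkeProduct (m : ℕ) (α : ℂ → ℂ) : Prop :=
  ∃ (c : ℂ) (a : Fin m → ℂ), ‖c‖ = 1 ∧ (∀ i, ‖a i‖ < 1) ∧
    ∀ z, α z = c * ∏ i, (a i - z) / (1 - (starRingEnd ℂ) (a i) * z)

/-- The number `α_λ = (λ + α(0)) / (1 + \bar{α(0)} λ)`. -/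
def clarkValue (α : ℂ → ℂ) (lam : ℂ) : ℂ :=
  (lam + α 0) / (1 + (starRingEnd ℂ) (α 0) * lam)

/-- `η₁, …, η_m` are `m` distinct solutions on the unit circle of the equation `α(η) = α_λ`
(a finite Blaschke product of degree `m > 0` has exactly `m` of them, so these are all). -/
def IsClarkPoints {m : ℕ} (α : ℂ → ℂ) (lam : ℂ) (η : Fin m → ℂ) : Prop :=
  Function.Injective η ∧ ∀ p, ‖η p‖ = 1 ∧ α (η p) = clarkValue α lam

/-- The kernel `k_η^α(z) = (1 - \bar{α(η)} α(z)) / (1 - \bar{η} z)`. -/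
def modelKernel (α : ℂ → ℂ) (η z : ℂ) : ℂ :=
  (1 - (starRingEnd ℂ) (α η) * α z) / (1 - (starRingEnd ℂ) η * z)

/-- The norm of `k_η^α` in `L²(∂𝔻)`. -/
def modelKernelNorm (α : ℂ → ℂ) (η : ℂ) : ℝ :=
  (eLpNorm (fun t : UnitAddCircle => modelKernel α η (circlePt t)) 2
    AddCircle.haarAddCircle).toReal

/-- The orthonormal basis `b` of `K_α` is the Clark basis attached to the points `η`: its `p`-th
element is the function `v_{η_p}^α = ‖k_{η_p}^α‖⁻¹ k_{η_p}^α` on the circle. -/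
def IsClarkBasis {m : ℕ} (α : ℂ → ℂ) (η : Fin m → ℂ)
    (b : OrthonormalBasis (Fin m) ℂ (modelSpace α)) : Prop :=
  ∀ p, (((b p : modelSpace α) : L2Circle) : UnitAddCircle → ℂ) =ᵐ[AddCircle.haarAddCircle]
    fun t => ((modelKernelNorm α (η p) : ℂ))⁻¹ * modelKernel α (η p) (circlePt t)

/-- The positions `(s, p)` of the determining entries of an `n × m` matrix. If `l = 0`: the first
row and the first column. If `l > 0`: the first row, the first `l` diagonal entries, and the
entries of the first column below the `l`-th row. (Rows and columns are counted from `0` here.) -/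
def determiningEntries (n m l : ℕ) : Set (Fin n × Fin m) :=
  {e | (e.1 : ℕ) = 0 ∨ ((e.1 : ℕ) = e.2 ∧ (e.1 : ℕ) < l) ∨ ((e.2 : ℕ) = 0 ∧ l ≤ e.1)}

end

/-! ### Analytic functions on the circle and their pairing with H². -/

noncomputable section

open AddCircle Metric ComplexConjugate

/-! A matrix entry of an operator with symbol φ is, up to the norms of the kernels, the integral of
φ against k^α_{η_p} · conj k^β_{ζ_s}. The theorem is therefore about linear relations between these
mn products.

With x = 1 - conj(w) α, where w is the common value of α at the η_p, and y formed likewise from β,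
each product equals η_p z x conj(y) / ((η_p - z)(z - ζ_s)) off a finite set. Since (η_p - ζ_s) /
((η_p - z)(z - ζ_s)) = 1/(η_p - z) + 1/(z - ζ_s), the product multiplied by (η_p - ζ_s)/η_p is a
function of p plus a function of s. The entry at (s, p) is thus a combination of those at (s, p'),
(s', p') and (s', p) (`circlePairing_rowCol`). If η_{p'} = ζ_s or η_{p'} = ζ_{s'}, one of the three
coefficients vanishes. This proves that the relations are necessary.

For the converse, the relations determine a matrix from its entries on E
(`ClarkRelations.eq_of_eqOn`), while the products indexed by E are linearly independent
(`coeff_eq_zero_of_sum_eq_zero`). A Gram matrix then yields a symbol with arbitrary entries on E. If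
A satisfies the relations, the operator with that symbol and the entries of A on E satisfies them
too, hence equals A. The same argument gives the existence and uniqueness for prescribed entries.

The Clark bases are obtained concretely: K_α consists of the polynomials of degree less than m over
the denominator D of α, and k_{η_p} has the numerator -κ η_p ∏_{q ≠ p} (z - η_q). -/

theorem continuous_circlePt : Continuous circlePt :=
  continuous_subtype_val.comp AddCircle.continuous_toCircle

@[simp] theorem norm_circlePt (t : UnitAddCircle) : ‖circlePt t‖ = 1 := Circle.norm_coe _

theorem circlePt_mem_closedBall (t : UnitAddCircle) : circlePt t ∈ closedBall (0 : ℂ) 1 := by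
  simp

@[simp] theorem circlePt_mul_conj (t : UnitAddCircle) : circlePt t * conj (circlePt t) = 1 := by
  rw [Complex.mul_conj']; simp

@[simp] theorem conj_mul_circlePt (t : UnitAddCircle) : conj (circlePt t) * circlePt t = 1 := by
  rw [mul_comm, circlePt_mul_conj]

theorem circlePt_injective : Function.Injective circlePt := fun _ _ h =>
  AddCircle.injective_toCircle one_ne_zero (Circle.ext h)

theorem circlePt_coe (x : ℝ) : circlePt (x : UnitAddCircle) = circleMap 0 1 (2 * Real.pi * x) := by
  simp [circlePt, AddCircle.toCircle_apply_mk, circleMap]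

theorem exists_circlePt_eq {z : ℂ} (hz : ‖z‖ = 1) : ∃ t, circlePt t = z := by
  refine ⟨((z.arg / (2 * Real.pi) : ℝ) : UnitAddCircle), ?_⟩
  rw [circlePt_coe, mul_div_cancel₀ _ (by positivity)]
  simpa [circleMap, hz] using Complex.norm_mul_exp_arg_mul_I z

theorem fourier_natCast_eq (n : ℕ) (t : UnitAddCircle) : fourier (n : ℤ) t = circlePt t ^ n := by
  rw [fourier_apply, AddCircle.toCircle_zsmul, zpow_natCast, Circle.coe_pow, circlePt]

theorem fourier_neg_natCast_eq (n : ℕ) (t : UnitAddCircle) :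
    fourier (-(n : ℤ)) t = conj (circlePt t) ^ n := by
  rw [fourier_neg, fourier_natCast_eq, map_pow]

theorem finite_setOf_circlePt {S : Set ℂ} (hS : S.Finite) : {t | circlePt t ∈ S}.Finite :=
  hS.preimage circlePt_injective.injOn

instance nullSingletonClass_unitAddCircle :
    NullSingletonClass (volume : Measure UnitAddCircle) where
  measure_singleton t := by
    have := AddCircle.volume_closedBall (T := 1) (x := t) 0
    simpa using this

/-- Lets the kernel formulas, which divide by zero at Clark points, be used almost everywhere. -/
theorem ae_circlePt_notMem {S : Set ℂ} (hS : S.Finite) :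
    ∀ᵐ t ∂(haarAddCircle : Measure UnitAddCircle), circlePt t ∉ S := by
  have h0 := (finite_setOf_circlePt hS).measure_zero (volume : Measure UnitAddCircle)
  rw [volume_eq_smul_haarAddCircle] at h0
  simpa [ae_iff] using h0

/-- The mean value property, which evaluates every integral of an analytic function below. -/
theorem integral_circlePt {g : ℂ → ℂ} (hg : DiffContOnCl ℂ g (ball 0 1)) :
    ∫ t, g (circlePt t) ∂(haarAddCircle : Measure UnitAddCircle) = g 0 := by
  have h := DiffContOnCl.circleAverage (f := g) (c := 0) (R := 1) (by simpa using hg)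
  rw [← h, Real.circleAverage_def, integral_haarAddCircle, inv_one, one_smul,
    ← UnitAddCircle.intervalIntegral_preimage 0]
  simp_rw [circlePt_coe]
  rw [intervalIntegral.integral_comp_mul_left (fun x => g (circleMap 0 1 x)) (by positivity)]
  simp

/-- The restriction to the circle of a function continuous on the closed disk. -/
def circleRestrict (g : ℂ → ℂ) (hg : ContinuousOn g (closedBall 0 1)) : C(UnitAddCircle, ℂ) :=
  ⟨fun t => g (circlePt t), hg.comp_continuous continuous_circlePt circlePt_mem_closedBall⟩

/-- The class in `L²(∂𝔻)` of a continuous function. -/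
abbrev contL2 (u : C(UnitAddCircle, ℂ)) : L2Circle := ContinuousMap.toLp 2 haarAddCircle ℂ u

theorem coeFn_contL2 (u : C(UnitAddCircle, ℂ)) : contL2 u =ᵐ[haarAddCircle] u :=
  ContinuousMap.coeFn_toLp _ _

theorem inner_contL2 (u : C(UnitAddCircle, ℂ)) (f : L2Circle) :
    inner ℂ (contL2 u) f = ∫ t, conj (u t) * f t ∂haarAddCircle := by
  rw [L2.inner_def]
  refine integral_congr_ae ?_
  filter_upwards [coeFn_contL2 u] with t ht
  rw [ht, RCLike.inner_apply']

theorem integrable_contMul (u : C(UnitAddCircle, ℂ)) (f : L2Circle) :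
    Integrable (fun t => u t * f t) (haarAddCircle : Measure UnitAddCircle) := by
  have hf : Integrable f (haarAddCircle : Measure UnitAddCircle) :=
    (Lp.memLp f).integrable (by norm_num)
  exact hf.bdd_mul (c := ‖u‖) u.continuous.aestronglyMeasurable
    (Filter.Eventually.of_forall fun t => u.norm_coe_le_norm t)

theorem memLp_contMul (u : C(UnitAddCircle, ℂ)) (f : L2Circle) :
    MemLp (fun t => u t * f t) 2 (haarAddCircle : Measure UnitAddCircle) := by
  refine MemLp.of_le_mul (c := ‖u‖) (Lp.memLp f)
    (u.continuous.aestronglyMeasurable.mul (Lp.aestronglyMeasurable f))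
    (Filter.Eventually.of_forall fun t => ?_)
  rw [norm_mul]
  exact mul_le_mul_of_nonneg_right (u.norm_coe_le_norm t) (norm_nonneg _)

theorem diffContOnCl_pow_mul {g : ℂ → ℂ} (hg : DiffContOnCl ℂ g (ball 0 1)) (n : ℕ) :
    DiffContOnCl ℂ (fun z => z ^ n * g z) (ball 0 1) :=
  (differentiable_id.pow n).diffContOnCl.smul hg

/-- A function analytic in the disk and vanishing at `0` is orthogonal to the conjugates of the
functions of `H²`. -/
theorem integral_mul_hardySpace {g : ℂ → ℂ} (hg : DiffContOnCl ℂ g (ball 0 1)) (h0 : g 0 = 0)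
    {h : L2Circle} (hh : h ∈ hardySpace) :
    ∫ t, g (circlePt t) * h t ∂haarAddCircle = 0 := by
  have hc : ContinuousOn g (closedBall 0 1) := by
    simpa [closure_ball] using hg.continuousOn
  set u : C(UnitAddCircle, ℂ) := star (circleRestrict g hc) with hu
  have hu' : ∀ t, u t = conj (g (circlePt t)) := fun t => rfl
  have h1 : inner ℂ (contL2 u) h = ∫ t, g (circlePt t) * h t ∂haarAddCircle := by
    rw [inner_contL2]; simp [hu']
  rw [← h1, ← fourierBasis.tsum_inner_mul_inner]
  -- In Parseval's sum, the terms with n < 0 vanish because h ∈ H², those with n ≥ 0 because z^n g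
  -- is analytic and vanishes at 0.
  have : ∀ n : ℤ, inner ℂ (contL2 u) (fourierBasis n) * inner ℂ (fourierBasis n) h = 0 := by
    intro n
    rcases lt_or_ge n 0 with hn | hn
    · have := hh n hn
      rw [← fourierBasis_repr, HilbertBasis.repr_apply_apply] at this
      rw [this, mul_zero]
    · obtain ⟨k, rfl⟩ := Int.eq_ofNat_of_zero_le hn
      have : inner ℂ (contL2 u) (fourierBasis (k : ℤ)) = 0 := by
        rw [inner_contL2]
        have e : ∀ᵐ t ∂(haarAddCircle : Measure UnitAddCircle),
            conj (u t) * (fourierBasis (k : ℤ) : L2Circle) t =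
              (fun z => z ^ k * g z) (circlePt t) := by
          rw [coe_fourierBasis]
          filter_upwards [coeFn_fourierLp (T := 1) 2 (k : ℤ)] with t ht
          rw [ht, hu', fourier_natCast_eq]; simp [mul_comm]
        rw [integral_congr_ae e, integral_circlePt (diffContOnCl_pow_mul hg k)]
        simp [h0]
      rw [this, zero_mul]
  simp_rw [this, tsum_zero]

theorem circleRestrict_mem_hardySpace {g : ℂ → ℂ} (hg : DiffContOnCl ℂ g (ball 0 1))
    {u : C(UnitAddCircle, ℂ)} (hu : ∀ t, u t = g (circlePt t)) : contL2 u ∈ hardySpace := by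
  intro n hn
  obtain ⟨k, rfl⟩ : ∃ k : ℕ, n = -(k : ℤ) := ⟨n.natAbs, by omega⟩
  rw [fourierCoeff_toLp, fourierCoeff]
  have : ∀ t, fourier (-(-(k : ℤ))) t • u t = (fun z => z ^ k * g z) (circlePt t) := by
    intro t; rw [neg_neg, fourier_natCast_eq, hu]; rfl
  simp_rw [this]
  rw [integral_circlePt (diffContOnCl_pow_mul hg k)]
  have : k ≠ 0 := by rintro rfl; simp at hn
  simp [this]
end

/-! ### The model space of a finite Blaschke product as a space of rational functions. -/

noncomputable section

open AddCircle Metric ComplexConjugate Polynomial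

/-- The denominator `∏ (1 - \bar{a_i} X)` of a finite Blaschke product. -/
def blaschkeDen {m : ℕ} (a : Fin m → ℂ) : ℂ[X] := ∏ i, (1 - C (conj (a i)) * X)

/-- The numerator `c ∏ (a_i - X)` of a finite Blaschke product. -/
def blaschkeNum {m : ℕ} (c : ℂ) (a : Fin m → ℂ) : ℂ[X] := C c * ∏ i, (C (a i) - X)

section
variable {m : ℕ} {a : Fin m → ℂ} {c : ℂ} {α : ℂ → ℂ}

theorem eval_blaschkeDen (z : ℂ) : (blaschkeDen a).eval z = ∏ i, (1 - conj (a i) * z) := by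
  simp [blaschkeDen, eval_prod]

theorem eval_blaschkeNum (z : ℂ) : (blaschkeNum c a).eval z = c * ∏ i, (a i - z) := by
  simp [blaschkeNum, eval_prod]

theorem eval_blaschkeDen_ne_zero (ha : ∀ i, ‖a i‖ < 1) {z : ℂ} (hz : ‖z‖ ≤ 1) :
    (blaschkeDen a).eval z ≠ 0 := by
  rw [eval_blaschkeDen, Finset.prod_ne_zero_iff]
  intro i _ h
  have h1 : ‖conj (a i) * z‖ = 1 := by rw [← sub_eq_zero.1 h, norm_one]
  rw [norm_mul, RCLike.norm_conj] at h1
  nlinarith [ha i, norm_nonneg (a i), norm_nonneg z]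

theorem blaschke_eq_div (hα : ∀ z, α z = c * ∏ i, (a i - z) / (1 - conj (a i) * z)) (z : ℂ) :
    α z = (blaschkeNum c a).eval z / (blaschkeDen a).eval z := by
  rw [hα, eval_blaschkeDen, eval_blaschkeNum, Finset.prod_div_distrib, mul_div_assoc]

/-- On the circle z · conj(1 - conj(a) z) = z - a, factor by factor. This converts conj D into the
numerator. -/
theorem circle_pow_mul_conj_eval_blaschkeDen {z : ℂ} (hz : ‖z‖ = 1) :
    c * z ^ m * conj ((blaschkeDen a).eval z) = (-1) ^ m * (blaschkeNum c a).eval z := by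
  have hz' : z * conj z = 1 := by rw [Complex.mul_conj']; simp [hz]
  rw [eval_blaschkeDen, eval_blaschkeNum, map_prod, mul_assoc, mul_left_comm ((-1) ^ m)]
  congr 1
  have h1 : z ^ m = ∏ _i : Fin m, z := by simp
  have h2 : (-1 : ℂ) ^ m = ∏ _i : Fin m, (-1 : ℂ) := by simp
  rw [h1, h2, ← Finset.prod_mul_distrib, ← Finset.prod_mul_distrib]
  refine Finset.prod_congr rfl fun i _ => ?_
  simp only [map_sub, map_one, map_mul, Complex.conj_conj]
  linear_combination -a i * hz'

theorem norm_blaschke_eq_one (hc : ‖c‖ = 1) (ha : ∀ i, ‖a i‖ < 1)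
    (hα : ∀ z, α z = c * ∏ i, (a i - z) / (1 - conj (a i) * z)) {z : ℂ} (hz : ‖z‖ = 1) :
    ‖α z‖ = 1 := by
  have h := congrArg norm (circle_pow_mul_conj_eval_blaschkeDen (a := a) (c := c) hz)
  simp only [norm_mul, norm_pow, hc, hz, RCLike.norm_conj, norm_neg, norm_one, one_pow,
    one_mul] at h
  rw [blaschke_eq_div hα, norm_div, ← h, div_self]
  exact norm_ne_zero_iff.2 (eval_blaschkeDen_ne_zero ha hz.le)

theorem diffContOnCl_div_blaschkeDen (ha : ∀ i, ‖a i‖ < 1) (Q : ℂ[X]) :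
    DiffContOnCl ℂ (fun z => Q.eval z / (blaschkeDen a).eval z) (ball 0 1) := by
  refine DifferentiableOn.diffContOnCl fun z hz => ?_
  rw [closure_ball _ one_ne_zero, mem_closedBall_zero_iff] at hz
  exact (Q.differentiable.differentiableAt.div (blaschkeDen a).differentiable.differentiableAt
    (eval_blaschkeDen_ne_zero ha hz)).differentiableWithinAt

theorem diffContOnCl_blaschke (ha : ∀ i, ‖a i‖ < 1)
    (hα : ∀ z, α z = c * ∏ i, (a i - z) / (1 - conj (a i) * z)) :
    DiffContOnCl ℂ α (ball 0 1) := by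
  rw [funext (blaschke_eq_div hα)]
  exact diffContOnCl_div_blaschkeDen ha _

theorem continuousOn_div_blaschkeDen (ha : ∀ i, ‖a i‖ < 1) (Q : ℂ[X]) :
    ContinuousOn (fun z => Q.eval z / (blaschkeDen a).eval z) (closedBall 0 1) := by
  simpa [closure_ball] using (diffContOnCl_div_blaschkeDen ha Q).continuousOn

/-- The function `Q / ∏ (1 - \bar{a_i} z)` on the circle. -/
def ratFun (ha : ∀ i, ‖a i‖ < 1) : ℂ[X] →ₗ[ℂ] C(UnitAddCircle, ℂ) where
  toFun Q := circleRestrict _ (continuousOn_div_blaschkeDen ha Q)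
  map_add' P Q := by
    ext t; simp [circleRestrict, add_div]
  map_smul' r Q := by
    ext t; simp [circleRestrict, mul_div_assoc]

theorem ratFun_apply (ha : ∀ i, ‖a i‖ < 1) (Q : ℂ[X]) (t : UnitAddCircle) :
    ratFun ha Q t = Q.eval (circlePt t) / (blaschkeDen a).eval (circlePt t) := rfl

/-- On the circle conj(z^k / D) · α is a constant times z^(m-k) / D. It is analytic and, as k < m,
vanishes at 0, so it is annihilated by pairing with H². -/
theorem contL2_ratFun_X_pow_mem_modelSpace (ha : ∀ i, ‖a i‖ < 1)
    (hα : ∀ z, α z = c * ∏ i, (a i - z) / (1 - conj (a i) * z)) {k : ℕ} (hk : k < m) :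
    contL2 (ratFun ha (X ^ k)) ∈ modelSpace α := by
  refine ⟨circleRestrict_mem_hardySpace (diffContOnCl_div_blaschkeDen ha (X ^ k))
    (fun t => rfl), ?_⟩
  rw [SetLike.mem_coe, Submodule.mem_orthogonal]
  rintro g ⟨h, hh, hg⟩
  rw [← inner_conj_symm, inner_contL2]
  have key : ∀ᵐ t ∂(haarAddCircle : Measure UnitAddCircle),
      conj (ratFun ha (X ^ k) t) * g t =
        (C ((-1) ^ m * c) * X ^ (m - k)).eval (circlePt t) /
          (blaschkeDen a).eval (circlePt t) * h t := by
    filter_upwards [hg] with t ht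
    rw [ht, ratFun_apply, ← mul_assoc]
    congr 1
    set z := circlePt t with hz
    have hz1 : ‖z‖ = 1 := norm_circlePt t
    have hD := eval_blaschkeDen_ne_zero ha hz1.le
    have hDc : conj ((blaschkeDen a).eval z) ≠ 0 := (_root_.map_ne_zero _).2 hD
    have hzz : conj z * z = 1 := conj_mul_circlePt t
    have h1 := circle_pow_mul_conj_eval_blaschkeDen (a := a) (c := c) hz1
    have h2 : z ^ m = z ^ (m - k) * z ^ k := by rw [← pow_add]; congr 1; omega
    have h3 : conj z ^ k * z ^ k = 1 := by rw [← mul_pow, hzz, one_pow]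
    have h4 : ((-1 : ℂ) ^ m) * (-1) ^ m = 1 := by rw [← mul_pow]; simp
    rw [blaschke_eq_div hα]
    simp only [eval_pow, eval_X, eval_mul, eval_C, map_div₀, map_pow]
    field_simp
    rw [h2] at h1
    linear_combination (-(-1) ^ m * conj z ^ k) * h1 -
      conj z ^ k * (blaschkeNum c a).eval z * h4 +
      (-1) ^ m * c * z ^ (m - k) * conj ((blaschkeDen a).eval z) * h3
  rw [integral_congr_ae key, integral_mul_hardySpace (diffContOnCl_div_blaschkeDen ha
    (C ((-1) ^ m * c) * X ^ (m - k))) _ hh, map_zero]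
  have : m - k ≠ 0 := by omega
  simp [this]

theorem contL2_ratFun_mem_modelSpace (ha : ∀ i, ‖a i‖ < 1)
    (hα : ∀ z, α z = c * ∏ i, (a i - z) / (1 - conj (a i) * z)) {Q : ℂ[X]}
    (hQ : Q.degree < m) : contL2 (ratFun ha Q) ∈ modelSpace α := by
  have h : degreeLT ℂ m ≤ (modelSpace α).comap
      ((ContinuousMap.toLp 2 haarAddCircle ℂ).toLinearMap ∘ₗ ratFun ha) := by
    classical
    rw [degreeLT_eq_span_X_pow, Submodule.span_le]
    intro P hP
    simp only [Finset.coe_image, Set.mem_image, Finset.mem_coe, Finset.mem_range] at hP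
    obtain ⟨k, hk, rfl⟩ := hP
    exact contL2_ratFun_X_pow_mem_modelSpace ha hα hk
  exact h (mem_degreeLT.2 hQ)

theorem mul_mem_mulHardySpace {g : ℂ → ℂ} (hg : DiffContOnCl ℂ g (ball 0 1)) {u : C(UnitAddCircle, ℂ)}
    (hu : ∀ t, u t = α (circlePt t) * g (circlePt t)) : contL2 u ∈ mulHardySpace α := by
  have hc : ContinuousOn g (closedBall 0 1) := by
    simpa [closure_ball] using hg.continuousOn
  refine ⟨contL2 (circleRestrict g hc), circleRestrict_mem_hardySpace hg fun t => rfl, ?_⟩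
  filter_upwards [coeFn_contL2 u, coeFn_contL2 (circleRestrict g hc)] with t h1 h2
  rw [h1, h2, hu]; rfl

/-- Below 0 this is analyticity of D f. From m on, the coefficient is the inner product of f with a
multiple of z^k times the numerator, that is, of α z^k D ∈ α H². -/
theorem fourierCoeff_blaschkeDen_mul (hc : ‖c‖ = 1) (ha : ∀ i, ‖a i‖ < 1)
    (hα : ∀ z, α z = c * ∏ i, (a i - z) / (1 - conj (a i) * z)) {f : L2Circle}
    (hf : f ∈ modelSpace α) {n : ℤ} (hn : n < 0 ∨ (m : ℤ) ≤ n) :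
    fourierCoeff (fun t => (blaschkeDen a).eval (circlePt t) * f t) n = 0 := by
  rw [fourierCoeff]
  rcases hn with hn | hn
  · obtain ⟨k, rfl⟩ : ∃ k : ℕ, n = -((k + 1 : ℕ) : ℤ) := ⟨n.natAbs - 1, by omega⟩
    have h := integral_mul_hardySpace
      (diffContOnCl_pow_mul (blaschkeDen a).differentiable.diffContOnCl (k + 1)) (by simp) hf.1
    rw [← h]
    congr 1; ext t
    rw [neg_neg, fourier_natCast_eq, smul_eq_mul, mul_assoc]
  · obtain ⟨k, rfl⟩ : ∃ k : ℕ, n = ((m + k : ℕ) : ℤ) := ⟨(n - m).toNat, by omega⟩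
    have hc0 : c ≠ 0 := norm_ne_zero_iff.1 (by rw [hc]; exact one_ne_zero)
    have hcont : ContinuousOn
        (fun z => c⁻¹ * (-1) ^ m * z ^ k * (blaschkeNum c a).eval z) (closedBall 0 1) := by
      fun_prop
    have hg : DiffContOnCl ℂ
        (fun z => c⁻¹ * (-1) ^ m * z ^ k * (blaschkeDen a).eval z) (ball 0 1) := by
      refine Differentiable.diffContOnCl ?_
      have := (blaschkeDen a).differentiable
      fun_prop
    have hmem := mul_mem_mulHardySpace (α := α) hg (u := circleRestrict _ hcont) (fun t => by
      have hD := eval_blaschkeDen_ne_zero ha (norm_circlePt t).le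
      rw [blaschke_eq_div hα, circleRestrict]
      simp only [ContinuousMap.coe_mk]
      field_simp)
    have h := (Submodule.mem_orthogonal _ _).1 hf.2 _ hmem
    rw [inner_contL2] at h
    rw [← h]
    congr 1; ext t
    rw [fourier_neg_natCast_eq, smul_eq_mul, ← mul_assoc]
    congr 1
    have h1 := circle_pow_mul_conj_eval_blaschkeDen (a := a) (c := c) (norm_circlePt t)
    have h5 : c⁻¹ * (-1) ^ m * circlePt t ^ k * (blaschkeNum c a).eval (circlePt t) =
        circlePt t ^ (m + k) * conj ((blaschkeDen a).eval (circlePt t)) := by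
      rw [pow_add]
      field_simp
      linear_combination - circlePt t ^ k * h1
    simp only [circleRestrict, ContinuousMap.coe_mk]
    rw [h5]
    simp

/-- By the vanishing of its Fourier coefficients, D f is a polynomial of degree less than m; then
divide by D. -/
theorem exists_eq_contL2_ratFun (hc : ‖c‖ = 1) (ha : ∀ i, ‖a i‖ < 1)
    (hα : ∀ z, α z = c * ∏ i, (a i - z) / (1 - conj (a i) * z)) {f : L2Circle}
    (hf : f ∈ modelSpace α) : ∃ Q : ℂ[X], Q.degree < m ∧ f = contL2 (ratFun ha Q) := by
  have hDc : Continuous fun t => (blaschkeDen a).eval (circlePt t) :=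
    (blaschkeDen a).continuous.comp continuous_circlePt
  have hmem : MemLp (fun t => (blaschkeDen a).eval (circlePt t) * f t) 2
      (haarAddCircle : Measure UnitAddCircle) := memLp_contMul ⟨_, hDc⟩ f
  set g : L2Circle := hmem.toLp _ with hg
  have hgc : g =ᵐ[haarAddCircle] fun t => (blaschkeDen a).eval (circlePt t) * f t :=
    hmem.coeFn_toLp
  have hcoef : ∀ n : ℤ, n < 0 ∨ (m : ℤ) ≤ n → fourierCoeff g n = 0 := fun n hn => by
    rw [fourierCoeff_congr_ae hgc, fourierCoeff_blaschkeDen_mul hc ha hα hf hn]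
  have hsum : g = ∑ k ∈ Finset.range m, fourierCoeff g k • fourierLp 2 (k : ℤ) := by
    refine (hasSum_fourier_series_L2 g).unique ?_
    have h2 := hasSum_sum_of_ne_finset_zero (L := .unconditional ℤ)
      (f := fun n : ℤ => fourierCoeff g n • (fourierLp 2 n : L2Circle))
      (s := (Finset.range m).map Nat.castEmbedding) (fun n hn => by
        rw [hcoef n, zero_smul]
        by_contra! hcon
        apply hn
        simp only [Finset.mem_map, Finset.mem_range]
        exact ⟨n.toNat, by omega, by simp; omega⟩)
    simpa using h2
  refine ⟨∑ k ∈ Finset.range m, C (fourierCoeff g k) * X ^ k, ?_, ?_⟩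
  · refine (Polynomial.degree_lt_iff_coeff_zero _ _).2 fun k hk => ?_
    simp only [finsetSum_coeff, coeff_C_mul_X_pow]
    refine Finset.sum_eq_zero fun j hj => if_neg ?_
    have := Finset.mem_range.1 hj
    omega
  · apply Lp.ext
    have hsum' : g = contL2 (∑ k ∈ Finset.range m, fourierCoeff g k • fourier (k : ℤ)) := by
      conv_lhs => rw [hsum]
      simp [contL2, fourierLp]
    have h3 := hgc
    rw [hsum'] at h3
    filter_upwards [h3, coeFn_contL2 (∑ k ∈ Finset.range m, fourierCoeff g k • fourier (k : ℤ)),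
      coeFn_contL2 (ratFun ha (∑ k ∈ Finset.range m, C (fourierCoeff g k) * X ^ k))]
      with t e1 e2 e3
    rw [e3, ratFun_apply, eq_div_iff (eval_blaschkeDen_ne_zero ha (norm_circlePt t).le),
      mul_comm]
    rw [← e1, e2, eval_finsetSum, ContinuousMap.sum_apply]
    refine Finset.sum_congr rfl fun k _ => ?_
    rw [ContinuousMap.smul_apply, fourier_natCast_eq]
    simp
end
end

/-! ### Clark points, kernels and the Clark orthonormal basis. -/

noncomputable section

open AddCircle Metric ComplexConjugate Polynomial

/-- `-κ η_p ∏_{q ≠ p} (X - η_q)`: for suitable `κ`, the numerator of the kernel `k_{η_p}`. -/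
def clarkPoly {m : ℕ} (κ : ℂ) (η : Fin m → ℂ) (p : Fin m) : ℂ[X] :=
  C (-κ * η p) * ∏ q ∈ Finset.univ.erase p, (X - C (η q))

section
variable {m : ℕ} {a : Fin m → ℂ} {c κ w : ℂ} {α : ℂ → ℂ} {η : Fin m → ℂ}

theorem natDegree_blaschkeDen_le : (blaschkeDen a).natDegree ≤ m := by
  refine (natDegree_prod_le _ _).trans ((Finset.sum_le_card_nsmul _ _ 1 fun i _ => ?_).trans ?_)
  · compute_degree
  · simp

theorem natDegree_blaschkeNum_le : (blaschkeNum c a).natDegree ≤ m := by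
  refine (natDegree_C_mul_le _ _).trans ((natDegree_prod_le _ _).trans
    ((Finset.sum_le_card_nsmul _ _ 1 fun i _ => ?_).trans ?_))
  · compute_degree
  · simp

/-- The left side is D (1 - conj(w) α). It has degree at most m and vanishes at the m distinct
points η_q because |w| = 1. -/
theorem exists_blaschkeDen_sub_eq [NeZero m] (hc : ‖c‖ = 1) (ha : ∀ i, ‖a i‖ < 1)
    (hα : ∀ z, α z = c * ∏ i, (a i - z) / (1 - conj (a i) * z))
    (hinj : Function.Injective η) (hη : ∀ p, ‖η p‖ = 1) (hw : ∀ p, α (η p) = w) :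
    ∃ κ : ℂ, κ ≠ 0 ∧ blaschkeDen a - C (conj w) * blaschkeNum c a =
      C κ * ∏ q, (X - C (η q)) := by
  have hw1 : conj w * w = 1 := by
    rw [Complex.conj_mul', ← hw 0, norm_blaschke_eq_one hc ha hα (hη 0)]; simp
  set R := blaschkeDen a - C (conj w) * blaschkeNum c a with hR
  -- At a zero of α the numerator vanishes and D does not.
  have hR0 : R ≠ 0 := by
    intro h
    have h1 := congrArg (eval (a 0)) h
    rw [hR, eval_sub, eval_mul, eval_blaschkeNum,
      Finset.prod_eq_zero (Finset.mem_univ (0 : Fin m)) (sub_self _)] at h1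
    simp only [mul_zero, sub_zero, eval_zero] at h1
    exact eval_blaschkeDen_ne_zero ha (ha 0).le h1
  have hdvd : (∏ q, (X - C (η q))) ∣ R := by
    refine Finset.prod_dvd_of_coprime
      (fun p _ q _ hpq => pairwise_coprime_X_sub_C hinj hpq) fun p _ => ?_
    rw [dvd_iff_isRoot, IsRoot.def, hR]
    have h2 := hw p
    rw [blaschke_eq_div hα, div_eq_iff (eval_blaschkeDen_ne_zero ha (hη p).le)] at h2
    simp only [eval_sub, eval_mul, eval_C, h2]
    linear_combination -(blaschkeDen a).eval (η p) * hw1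
  obtain ⟨S, hS⟩ := hdvd
  have hS0 : S ≠ 0 := by rintro rfl; exact hR0 (by rw [hS, mul_zero])
  have hmon : (∏ q, (X - C (η q))).Monic := monic_prod_X_sub_C _ _
  have hdeg : R.natDegree ≤ m :=
    (natDegree_sub_le_of_le natDegree_blaschkeDen_le
      ((natDegree_C_mul_le _ _).trans natDegree_blaschkeNum_le)).trans (max_self m).le
  have hdeg2 : R.natDegree = m + S.natDegree := by
    rw [hS, hmon.natDegree_mul' hS0, natDegree_finsetProd_X_sub_C_eq_card]; simp
  obtain ⟨κ, hκ⟩ := natDegree_eq_zero.1 (show S.natDegree = 0 by omega)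
  refine ⟨κ, ?_, by rw [hS, ← hκ, mul_comm]⟩
  rintro rfl
  exact hS0 (by rw [← hκ, C_0])

theorem degree_clarkPoly_lt (p : Fin m) : (clarkPoly κ η p).degree < m := by
  refine (degree_mul_le _ _).trans_lt ?_
  rw [degree_prod, Finset.sum_congr rfl fun q _ => degree_X_sub_C (η q), Finset.sum_const, nsmul_one]
  have hm : 0 < m := p.pos
  have h1 : ((Finset.univ.erase p).card : WithBot ℕ) < m := by
    rw [Finset.card_erase_of_mem (Finset.mem_univ p)]
    simp only [Finset.card_univ, Fintype.card_fin, Nat.cast_lt]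
    omega
  calc _ ≤ 0 + ((Finset.univ.erase p).card : WithBot ℕ) := by gcongr; exact degree_C_le
    _ < m := by rwa [zero_add]

theorem eval_clarkPoly_eq_zero_iff (hκ : κ ≠ 0) (hη : ∀ p, ‖η p‖ = 1) (p : Fin m) (z : ℂ) :
    (clarkPoly κ η p).eval z = 0 ↔ ∃ q, q ≠ p ∧ z = η q := by
  have : η p ≠ 0 := norm_ne_zero_iff.1 (by rw [hη]; exact one_ne_zero)
  simp [clarkPoly, eval_prod, Finset.prod_eq_zero_iff, sub_eq_zero, hκ, this]

theorem eval_clarkPoly_self_ne_zero (hκ : κ ≠ 0) (hη : ∀ p, ‖η p‖ = 1)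
    (hinj : Function.Injective η) (p : Fin m) : (clarkPoly κ η p).eval (η p) ≠ 0 := by
  rw [Ne, eval_clarkPoly_eq_zero_iff hκ hη]
  rintro ⟨q, hq, h⟩
  exact hq (hinj h.symm)

theorem clarkPoly_mul (p : Fin m) :
    clarkPoly κ η p * (C (η p) - X) = C (η p) * (C κ * ∏ q, (X - C (η q))) := by
  rw [clarkPoly, ← Finset.mul_prod_erase _ _ (Finset.mem_univ p)]
  simp only [map_mul, map_neg]
  ring

/-- Lagrange interpolation at the nodes η_q. -/
theorem exists_eq_sum_clarkPoly (hκ : κ ≠ 0) (hη : ∀ p, ‖η p‖ = 1)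
    (hinj : Function.Injective η) {Q : ℂ[X]} (hQ : Q.degree < m) :
    ∃ d : Fin m → ℂ, Q = ∑ q, d q • clarkPoly κ η q := by
  refine ⟨fun q => Q.eval (η q) / (clarkPoly κ η q).eval (η q), ?_⟩
  refine Polynomial.eq_of_degrees_lt_of_eval_index_eq (v := η) Finset.univ hinj.injOn
    (by simpa using hQ) ?_ fun p _ => ?_
  · rw [← mem_degreeLT]
    refine Submodule.sum_mem _ fun q _ => Submodule.smul_mem _ _ (mem_degreeLT.2 ?_)
    simpa using degree_clarkPoly_lt q
  · rw [eval_finsetSum, Finset.sum_eq_single p]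
    · rw [eval_smul, smul_eq_mul, div_mul_cancel₀ _ (eval_clarkPoly_self_ne_zero hκ hη hinj p)]
    · intro q _ hqp
      rw [eval_smul, (eval_clarkPoly_eq_zero_iff hκ hη q _).2 ⟨p, hqp.symm, rfl⟩, smul_zero]
    · simp

/-- Data attached to a finite Blaschke product and its Clark points. -/
structure ClarkData (c : ℂ) (a : Fin m → ℂ) (α : ℂ → ℂ) (w κ : ℂ) (η : Fin m → ℂ) : Prop where
  hc : ‖c‖ = 1
  ha : ∀ i, ‖a i‖ < 1
  hα : ∀ z, α z = c * ∏ i, (a i - z) / (1 - conj (a i) * z)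
  inj : Function.Injective η
  hη : ∀ p, ‖η p‖ = 1
  hw : ∀ p, α (η p) = w
  hw1 : ‖w‖ = 1
  hκ : κ ≠ 0
  eq : blaschkeDen a - C (conj w) * blaschkeNum c a = C κ * ∏ q, (X - C (η q))

namespace ClarkData
variable (H : ClarkData c a α w κ η)
include H

theorem ratFun_mul (p : Fin m) (z : ℂ) (hz : ‖z‖ ≤ 1) :
    (clarkPoly κ η p).eval z / (blaschkeDen a).eval z * (η p - z) =
      η p * (1 - conj w * α z) := by
  have hD := eval_blaschkeDen_ne_zero H.ha hz
  have h1 := congrArg (eval z) (clarkPoly_mul (κ := κ) (η := η) p)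
  rw [← H.eq] at h1
  simp only [eval_mul, eval_sub, eval_C, eval_X] at h1
  rw [blaschke_eq_div H.hα]
  field_simp
  linear_combination h1

theorem conj_mul (p : Fin m) : conj (η p) * η p = 1 := by
  rw [Complex.conj_mul', H.hη]; simp

theorem ratFun_eq_modelKernel (p : Fin m) (z : ℂ) (hz : ‖z‖ ≤ 1) (hzp : z ≠ η p) :
    (clarkPoly κ η p).eval z / (blaschkeDen a).eval z = modelKernel α (η p) z := by
  have h1 := H.ratFun_mul p z hz
  have h2 := H.conj_mul p
  have h3 : 1 - conj (η p) * z ≠ 0 := by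
    intro h
    apply hzp
    linear_combination (-η p) * h - z * h2
  rw [modelKernel, H.hw, eq_div_iff h3]
  linear_combination conj (η p) * h1 +
    (1 - conj w * α z - (clarkPoly κ η p).eval z / (blaschkeDen a).eval z) * h2

/-- Only almost everywhere: at η_p the quotient defining the kernel is 0/0, hence 0 by convention,
while the continuous representative is nonzero there. -/
theorem ae_eq_modelKernel (p : Fin m) :
    (fun t => modelKernel α (η p) (circlePt t)) =ᵐ[haarAddCircle]
      ratFun H.ha (clarkPoly κ η p) := by
  filter_upwards [ae_circlePt_notMem (Set.finite_singleton (η p))] with t ht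
  rw [ratFun_apply, H.ratFun_eq_modelKernel p _ (norm_circlePt t).le ht]

/-- The `L²` class of the kernel `k_{η_p}`. -/
def kernelL2 (p : Fin m) : L2Circle := contL2 (ratFun H.ha (clarkPoly κ η p))

theorem modelKernelNorm_eq (p : Fin m) : modelKernelNorm α (η p) = ‖H.kernelL2 p‖ := by
  rw [modelKernelNorm, eLpNorm_congr_ae (H.ae_eq_modelKernel p), Lp.norm_def]
  exact congrArg _ (eLpNorm_congr_ae (coeFn_contL2 _).symm)

theorem kernelL2_mem (p : Fin m) : H.kernelL2 p ∈ modelSpace α :=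
  contL2_ratFun_mem_modelSpace H.ha H.hα (degree_clarkPoly_lt p)

theorem continuousOn_blaschke : ContinuousOn α (closedBall 0 1) := by
  simpa [closure_ball] using (diffContOnCl_blaschke H.ha H.hα).continuousOn

theorem integral_conj_blaschke_mul {f : L2Circle} (hf : f ∈ modelSpace α) :
    ∫ t, conj (α (circlePt t)) * f t ∂haarAddCircle = 0 := by
  have h1 : contL2 (circleRestrict α H.continuousOn_blaschke) ∈ mulHardySpace α :=
    mul_mem_mulHardySpace (g := fun _ => 1) diffContOnCl_const
      fun t => (mul_one _).symm
  have h2 := (Submodule.mem_orthogonal _ _).1 hf.2 _ h1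
  rwa [inner_contL2] at h2

theorem integral_conj_blaschke_mul_ratFun {Q : ℂ[X]} (hQ : Q.degree < m) :
    ∫ t, conj (α (circlePt t)) * ratFun H.ha Q t ∂haarAddCircle = 0 := by
  rw [← H.integral_conj_blaschke_mul (contL2_ratFun_mem_modelSpace H.ha H.hα hQ)]
  refine integral_congr_ae ?_
  filter_upwards [coeFn_contL2 (ratFun H.ha Q)] with t ht
  rw [ht]

/-- The term with conj α drops out because α ∈ α H² is orthogonal to K_α; the rest is the mean value
property. It is used with x = w for orthogonality and with x = α(0) for the norms. -/
theorem integral_one_sub_mul_ratFun (x : ℂ) {Q : ℂ[X]} (hQ : Q.degree < m) :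
    ∫ t, (1 - x * conj (α (circlePt t))) * ratFun H.ha Q t ∂haarAddCircle =
      Q.eval 0 / (blaschkeDen a).eval 0 := by
  have hcα : Continuous fun t => α (circlePt t) :=
    (circleRestrict α H.continuousOn_blaschke).continuous
  have hcQ := (ratFun H.ha Q).continuous
  have hi1 : Integrable (fun t => ratFun H.ha Q t) (haarAddCircle : Measure UnitAddCircle) :=
    hcQ.integrable_of_hasCompactSupport (HasCompactSupport.of_compactSpace _)
  have hi2 : Integrable (fun t => x * (conj (α (circlePt t)) * ratFun H.ha Q t))
      (haarAddCircle : Measure UnitAddCircle) := by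
    refine Continuous.integrable_of_hasCompactSupport ?_ (HasCompactSupport.of_compactSpace _)
    exact continuous_const.mul ((Complex.continuous_conj.comp hcα).mul hcQ)
  simp_rw [sub_mul, one_mul, mul_assoc]
  rw [integral_sub hi1 hi2, integral_const_mul, H.integral_conj_blaschke_mul_ratFun hQ,
    mul_zero, sub_zero]
  exact integral_circlePt (diffContOnCl_div_blaschkeDen H.ha Q)

theorem inner_contL2_ratFun (u : C(UnitAddCircle, ℂ)) (Q : ℂ[X]) :
    inner ℂ (contL2 u) (contL2 (ratFun H.ha Q)) =
      ∫ t, conj (u t) * ratFun H.ha Q t ∂haarAddCircle := by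
  rw [inner_contL2]
  refine integral_congr_ae ?_
  filter_upwards [coeFn_contL2 (ratFun H.ha Q)] with t ht
  rw [ht]

/-- On the circle conj(k_p) (z - η_p) = z (1 - w conj α), and k_q contains the factor z - η_p. The
integrand becomes (1 - w conj α) z F / D, and z F / D vanishes at 0. -/
theorem inner_kernelL2_of_ne {p q : Fin m} (hpq : p ≠ q) :
    inner ℂ (H.kernelL2 p) (H.kernelL2 q) = 0 := by
  set F : ℂ[X] := C (-κ * η q) * ∏ r ∈ (Finset.univ.erase q).erase p, (X - C (η r)) with hF
  have hFq : clarkPoly κ η q = (X - C (η p)) * F := by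
    rw [clarkPoly, hF, ← Finset.mul_prod_erase (Finset.univ.erase q) _
      (Finset.mem_erase.2 ⟨hpq, Finset.mem_univ p⟩)]
    ring
  have hdeg : (X * F).degree < (m : WithBot ℕ) := by
    have h := degree_clarkPoly_lt (κ := κ) (η := η) q
    rw [hFq, degree_mul, degree_X_sub_C] at h
    rwa [degree_mul, degree_X]
  have h := H.integral_one_sub_mul_ratFun w hdeg
  rw [kernelL2, kernelL2, H.inner_contL2_ratFun]
  simp only [eval_mul, eval_X, zero_mul, zero_div] at h
  rw [← h]
  congr 1; ext t
  have h1 := congrArg conj (H.ratFun_mul p _ (norm_circlePt t).le)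
  rw [ratFun_apply, ratFun_apply, ratFun_apply, hFq]
  simp only [eval_mul, eval_sub, eval_X, eval_C, map_mul, map_sub, map_one,
    Complex.conj_conj] at h1 ⊢
  have h2 := H.conj_mul p
  have h3 := conj_mul_circlePt t
  set z := circlePt t
  set B := conj ((clarkPoly κ η p).eval z / (blaschkeDen a).eval z)
  have h4 : B * (z - η p) = z * (1 - w * conj (α z)) := by
    linear_combination η p * z * h1 - B * η p * h3 * (-1) +
      (z * (1 - w * conj (α z)) - B * z) * h2
  calc _ = B * (z - η p) * (F.eval z / (blaschkeDen a).eval z) := by ring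
    _ = _ := by rw [h4]; ring

/-- This function is the reproducing kernel at 0. Since |α| = 1 on the circle, pairing it with α h
leaves (α - α(0)) h, whose integral is 0. -/
theorem contL2_one_sub_mem :
    contL2 (1 - conj (α 0) • circleRestrict α H.continuousOn_blaschke) ∈ modelSpace α := by
  have hd := diffContOnCl_blaschke H.ha H.hα
  refine ⟨circleRestrict_mem_hardySpace (g := fun z => 1 - conj (α 0) * α z)
    (diffContOnCl_const.sub (hd.const_smul (conj (α 0)))) (fun t => rfl), ?_⟩
  rw [SetLike.mem_coe, Submodule.mem_orthogonal]
  rintro g ⟨h, hh, hg⟩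
  rw [← inner_conj_symm, inner_contL2]
  have key : ∀ᵐ t ∂(haarAddCircle : Measure UnitAddCircle),
      conj ((1 - conj (α 0) • circleRestrict α H.continuousOn_blaschke :
        C(UnitAddCircle, ℂ)) t) * g t = (fun z => α z - α 0) (circlePt t) * h t := by
    filter_upwards [hg] with t ht
    have h1 : conj (α (circlePt t)) * α (circlePt t) = 1 := by
      rw [Complex.conj_mul', norm_blaschke_eq_one H.hc H.ha H.hα (norm_circlePt t)]; simp
    rw [ht]
    simp only [circleRestrict, ContinuousMap.sub_apply, ContinuousMap.smul_apply,
      ContinuousMap.coe_mk, ContinuousMap.one_apply, map_sub, map_one, smul_eq_mul, map_mul,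
      Complex.conj_conj]
    linear_combination -α 0 * h t * h1
  have hd' : DiffContOnCl ℂ (fun z => α z - α 0) (ball 0 1) := hd.sub diffContOnCl_const
  rw [integral_congr_ae key, integral_mul_hardySpace hd' (sub_self _) hh, map_zero]

theorem exists_eq_sum_kernelL2 {f : L2Circle} (hf : f ∈ modelSpace α) :
    ∃ d : Fin m → ℂ, f = contL2 (∑ q, d q • ratFun H.ha (clarkPoly κ η q)) := by
  obtain ⟨Q, hQ, rfl⟩ := exists_eq_contL2_ratFun H.hc H.ha H.hα hf
  obtain ⟨d, rfl⟩ := exists_eq_sum_clarkPoly H.hκ H.hη H.inj hQ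
  exact ⟨d, by simp only [map_sum, map_smul]⟩

theorem kernelL2_sum (d : Fin m → ℂ) :
    contL2 (∑ q, d q • ratFun H.ha (clarkPoly κ η q)) = ∑ q, d q • H.kernelL2 q := by
  simp only [contL2, kernelL2, map_sum, map_smul]

theorem ratFun_eq_zero_iff (p : Fin m) (t : UnitAddCircle) :
    ratFun H.ha (clarkPoly κ η p) t = 0 ↔ ∃ q, q ≠ p ∧ circlePt t = η q := by
  rw [ratFun_apply, div_eq_zero_iff, eval_clarkPoly_eq_zero_iff H.hκ H.hη,
    or_iff_left (eval_blaschkeDen_ne_zero H.ha (norm_circlePt t).le)]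

/-- The coefficient d_p of the reproducing kernel at 0 is computed twice. Evaluation at η_p, where
the other kernels vanish, gives d_p k_p(η_p) = 1 - conj(α(0)) w. The inner product with k_p gives
conj(d_p) ‖k_p‖² = k_p(0) = 1 - conj(w) α(0). Comparing the two gives ‖k_p‖² = k_p(η_p). -/
theorem inner_kernelL2_self (p : Fin m) :
    inner ℂ (H.kernelL2 p) (H.kernelL2 p) =
      (clarkPoly κ η p).eval (η p) / (blaschkeDen a).eval (η p) := by
  obtain ⟨d, hd⟩ := H.exists_eq_sum_kernelL2 H.contL2_one_sub_mem
  obtain ⟨t, ht⟩ := exists_circlePt_eq (H.hη p)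
  have hpt := congrArg (fun u : C(UnitAddCircle, ℂ) => u t)
    (ContinuousMap.toLp_injective (p := 2) (𝕜 := ℂ) (haarAddCircle : Measure UnitAddCircle) hd)
  simp only [circleRestrict, ContinuousMap.sub_apply, ContinuousMap.smul_apply,
    ContinuousMap.coe_mk, ContinuousMap.one_apply, smul_eq_mul, ContinuousMap.sum_apply] at hpt
  rw [Finset.sum_eq_single p (fun q _ hq => by
    rw [(H.ratFun_eq_zero_iff q t).2 ⟨p, hq.symm, ht⟩, mul_zero]) (by simp),
    ratFun_apply H.ha, ht,
    H.hw] at hpt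
  have hin : inner ℂ (contL2 (1 - conj (α 0) • circleRestrict α H.continuousOn_blaschke))
      (H.kernelL2 p) = (clarkPoly κ η p).eval 0 / (blaschkeDen a).eval 0 := by
    rw [kernelL2, H.inner_contL2_ratFun,
      ← H.integral_one_sub_mul_ratFun (α 0) (degree_clarkPoly_lt p)]
    congr 1; ext t
    simp [circleRestrict]
  have h0 := H.ratFun_mul p 0 (by simp)
  have hη0 : η p ≠ 0 := norm_ne_zero_iff.1 (by rw [H.hη]; exact one_ne_zero)
  have h1 : (clarkPoly κ η p).eval 0 / (blaschkeDen a).eval 0 = 1 - conj w * α 0 := by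
    rw [sub_zero, mul_comm] at h0
    exact mul_left_cancel₀ hη0 h0
  -- This number is k_p(0), and the zeros of the numerator of k_p lie on the unit circle. It makes
  -- d_p nonzero, so that d_p can be cancelled.
  have h2 : 1 - conj w * α 0 ≠ 0 := by
    rw [← h1]
    refine div_ne_zero ?_ (eval_blaschkeDen_ne_zero H.ha (by simp))
    rw [Ne, eval_clarkPoly_eq_zero_iff H.hκ H.hη]
    rintro ⟨q, _, hq⟩
    have := H.hη q
    rw [← hq, norm_zero] at this
    exact zero_ne_one this
  rw [h1, hd, H.kernelL2_sum, sum_inner, Finset.sum_eq_single p (fun q _ hq => by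
    rw [inner_smul_left, H.inner_kernelL2_of_ne hq, mul_zero]) (by simp), inner_smul_left] at hin
  have hin' := congrArg conj hin
  simp only [map_mul, map_sub, map_one, Complex.conj_conj, inner_conj_symm] at hin'
  have hd0 : d p ≠ 0 := by
    intro h
    rw [h, map_zero, zero_mul] at hin
    exact h2 hin.symm
  refine mul_left_cancel₀ hd0 ?_
  rw [hin', ← hpt]
  ring

/-- Differentiate k_p(z) (η_p - z) = η_p (1 - conj(w) α(z)), with D cleared, at z = η_p. -/
theorem eval_clarkPoly_div_eq_deriv (p : Fin m) :
    (clarkPoly κ η p).eval (η p) / (blaschkeDen a).eval (η p) =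
      η p * conj w * deriv α (η p) := by
  have hD := eval_blaschkeDen_ne_zero H.ha (H.hη p).le
  have h1 := congrArg (fun P => eval (η p) (derivative P)) (clarkPoly_mul (κ := κ) (η := η) p)
  rw [← H.eq] at h1
  simp only [derivative_mul, derivative_sub, derivative_C, derivative_X, eval_add, eval_mul,
    eval_sub, eval_C, eval_X, eval_zero, eval_one] at h1
  have h2 : deriv α (η p) = ((derivative (blaschkeNum c a)).eval (η p) *
      (blaschkeDen a).eval (η p) - (blaschkeNum c a).eval (η p) *
      (derivative (blaschkeDen a)).eval (η p)) / (blaschkeDen a).eval (η p) ^ 2 := by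
    rw [funext (blaschke_eq_div H.hα)]
    exact (((blaschkeNum c a).hasDerivAt _).div ((blaschkeDen a).hasDerivAt _) hD).deriv
  have h3 := H.hw p
  rw [blaschke_eq_div H.hα, div_eq_iff hD] at h3
  have h4 : conj w * w = 1 := by rw [Complex.conj_mul', H.hw1]; simp
  rw [h2, h3]
  field_simp
  linear_combination - h1 + η p * (derivative (blaschkeDen a)).eval (η p) * h4

theorem norm_kernelL2 (p : Fin m) : ‖H.kernelL2 p‖ = √‖deriv α (η p)‖ := by
  rw [eq_comm, Real.sqrt_eq_iff_mul_self_eq (norm_nonneg _) (norm_nonneg _), ← pow_two]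
  have h := congrArg norm (H.inner_kernelL2_self p)
  rw [H.eval_clarkPoly_div_eq_deriv, inner_self_eq_norm_sq_to_K] at h
  simpa [H.hη, H.hw1] using h.symm

theorem norm_kernelL2_pos (p : Fin m) : 0 < ‖H.kernelL2 p‖ := by
  rw [norm_pos_iff, ← inner_self_ne_zero (𝕜 := ℂ), H.inner_kernelL2_self]
  exact div_ne_zero (eval_clarkPoly_self_ne_zero H.hκ H.hη H.inj p)
    (eval_blaschkeDen_ne_zero H.ha (H.hη p).le)

/-- The normalized kernel `v_{η_p}` as an element of the model space. -/
def clarkVector (p : Fin m) : modelSpace α :=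
  ((√‖deriv α (η p)‖ : ℂ))⁻¹ • ⟨H.kernelL2 p, H.kernelL2_mem p⟩

theorem coe_clarkVector (p : Fin m) :
    (H.clarkVector p : L2Circle) = ((√‖deriv α (η p)‖ : ℂ))⁻¹ • H.kernelL2 p := rfl

theorem orthonormal_clarkVector : Orthonormal ℂ H.clarkVector := by
  refine ⟨fun p => ?_, fun p q hpq => ?_⟩
  · rw [clarkVector, norm_smul, ← H.norm_kernelL2, norm_inv, Complex.norm_real, norm_norm]
    exact inv_mul_cancel₀ (H.norm_kernelL2_pos p).ne'
  · change inner ℂ (H.clarkVector p) (H.clarkVector q) = 0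
    rw [Submodule.coe_inner, H.coe_clarkVector, H.coe_clarkVector, inner_smul_left,
      inner_smul_right, H.inner_kernelL2_of_ne hpq, mul_zero, mul_zero]

theorem span_clarkVector : ⊤ ≤ Submodule.span ℂ (Set.range H.clarkVector) := by
  rintro ⟨f, hf⟩ -
  obtain ⟨d, hd⟩ := H.exists_eq_sum_kernelL2 hf
  have : (⟨f, hf⟩ : modelSpace α) =
      ∑ q, (d q * (√‖deriv α (η q)‖ : ℂ)) • H.clarkVector q := by
    apply Subtype.ext
    change f = _
    rw [hd, H.kernelL2_sum, Submodule.coe_sum]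
    refine Finset.sum_congr rfl fun q _ => ?_
    have h0 : (√‖deriv α (η q)‖ : ℂ) ≠ 0 := by
      rw [← H.norm_kernelL2]; exact_mod_cast (H.norm_kernelL2_pos q).ne'
    rw [clarkVector, smul_smul, mul_assoc, mul_inv_cancel₀ h0, mul_one]
    rfl
  rw [this]
  exact Submodule.sum_mem _ fun q _ => Submodule.smul_mem _ _ (Submodule.subset_span ⟨q, rfl⟩)

/-- The Clark basis. -/
def clarkBasis : OrthonormalBasis (Fin m) ℂ (modelSpace α) :=
  OrthonormalBasis.mk H.orthonormal_clarkVector H.span_clarkVector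

theorem coeFn_clarkBasis (p : Fin m) :
    (((H.clarkBasis p : modelSpace α) : L2Circle) : UnitAddCircle → ℂ) =ᵐ[haarAddCircle]
      fun t => ((√‖deriv α (η p)‖ : ℂ))⁻¹ * ratFun H.ha (clarkPoly κ η p) t := by
  have h : ((H.clarkBasis p : modelSpace α) : L2Circle) =
      ((√‖deriv α (η p)‖ : ℂ))⁻¹ • contL2 (ratFun H.ha (clarkPoly κ η p)) := by
    rw [clarkBasis, OrthonormalBasis.coe_mk]; rfl
  rw [h]
  filter_upwards [Lp.coeFn_smul ((√‖deriv α (η p)‖ : ℂ))⁻¹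
    (contL2 (ratFun H.ha (clarkPoly κ η p))), coeFn_contL2 (ratFun H.ha (clarkPoly κ η p))]
    with t h1 h2
  rw [h1, Pi.smul_apply, h2, smul_eq_mul]

theorem isClarkBasis : IsClarkBasis α η H.clarkBasis := by
  intro p
  filter_upwards [H.coeFn_clarkBasis p, H.ae_eq_modelKernel p] with t h1 h2
  rw [h1, H.modelKernelNorm_eq, H.norm_kernelL2, h2]

end ClarkData

/-- The Clark basis of the model space of a finite Blaschke product, with continuous
representatives `B p` of the kernels `k_{η_p}`. -/
theorem exists_clarkBasis [NeZero m] {lam : ℂ} (hα : IsFiniteBlaschkeProduct m α)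
    (hη : IsClarkPoints α lam η) :
    ∃ (v : OrthonormalBasis (Fin m) ℂ (modelSpace α)) (B : Fin m → C(UnitAddCircle, ℂ))
      (x : UnitAddCircle → ℂ),
      IsClarkBasis α η v ∧ (∀ p, 0 < √‖deriv α (η p)‖) ∧
      (∀ p, (((v p : modelSpace α) : L2Circle) : UnitAddCircle → ℂ) =ᵐ[haarAddCircle]
        fun t => ((√‖deriv α (η p)‖ : ℂ))⁻¹ * B p t) ∧
      (∀ p t, B p t = 0 ↔ ∃ q, q ≠ p ∧ circlePt t = η q) ∧
      (∀ p t, B p t * (η p - circlePt t) = η p * x t) := by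
  obtain ⟨c, a, hc, ha, hα⟩ := hα
  obtain ⟨hinj, hη⟩ := hη
  obtain ⟨κ, hκ, heq⟩ := exists_blaschkeDen_sub_eq hc ha hα hinj (fun p => (hη p).1)
    fun p => (hη p).2
  have H : ClarkData c a α (clarkValue α lam) κ η := ⟨hc, ha, hα, hinj, fun p => (hη p).1,
    fun p => (hη p).2, by rw [← (hη 0).2]; exact norm_blaschke_eq_one hc ha hα (hη 0).1, hκ, heq⟩
  exact ⟨H.clarkBasis, fun p => ratFun H.ha (clarkPoly κ η p),
    fun t => 1 - conj (clarkValue α lam) * α (circlePt t), H.isClarkBasis,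
    fun p => by rw [← H.norm_kernelL2]; exact H.norm_kernelL2_pos p, H.coeFn_clarkBasis,
    H.ratFun_eq_zero_iff, fun p t => H.ratFun_mul p _ (norm_circlePt t).le⟩
end
end

/-! ### Matrix entries as pairings of the symbol with kernel products. -/

noncomputable section

open AddCircle Metric ComplexConjugate

/-- The bilinear pairing `∫ g φ` over the circle. -/
def circlePairing (φ : L2Circle) (g : C(UnitAddCircle, ℂ)) : ℂ :=
  ∫ t, g t * φ t ∂haarAddCircle

theorem circlePairing_congr (φ : L2Circle) {g g₁ g₂ g₃ : C(UnitAddCircle, ℂ)} {k₁ k₂ k₃ : ℂ}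
    (h : ∀ᵐ t ∂(haarAddCircle : Measure UnitAddCircle),
      g t = k₁ * g₁ t + k₂ * g₂ t + k₃ * g₃ t) :
    circlePairing φ g = k₁ * circlePairing φ g₁ + k₂ * circlePairing φ g₂ +
      k₃ * circlePairing φ g₃ := by
  have h₁ := (integrable_contMul g₁ φ).const_mul k₁
  have h₂ := (integrable_contMul g₂ φ).const_mul k₂
  have h₃ := (integrable_contMul g₃ φ).const_mul k₃
  have key : circlePairing φ g =
      ∫ t, k₁ * (g₁ t * φ t) + k₂ * (g₂ t * φ t) + k₃ * (g₃ t * φ t) ∂haarAddCircle := by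
    refine integral_congr_ae ?_
    filter_upwards [h] with t ht
    rw [ht]; ring
  have h₁₂ : Integrable (fun t => k₁ * (g₁ t * φ t) + k₂ * (g₂ t * φ t))
      (haarAddCircle : Measure UnitAddCircle) := h₁.add h₂
  rw [key, integral_add h₁₂ h₃, integral_add h₁ h₂]
  simp only [integral_const_mul, circlePairing]

theorem circlePairing_sum (φ : L2Circle) {ι : Type*} [Fintype ι] (k : ι → ℂ)
    (g : ι → C(UnitAddCircle, ℂ)) :
    circlePairing φ (∑ i, k i • g i) = ∑ i, k i * circlePairing φ (g i) := by
  simp only [circlePairing, ← integral_const_mul]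
  rw [← integral_finsetSum _ fun i _ => (integrable_contMul (g i) φ).const_mul (k i)]
  congr 1; ext t
  simp [ContinuousMap.sum_apply, Finset.sum_mul, mul_assoc]

theorem inner_contL2_star (φ : L2Circle) (g : C(UnitAddCircle, ℂ)) :
    inner ℂ (contL2 (star g)) φ = circlePairing φ g := by
  rw [inner_contL2, circlePairing]
  simp

/-- The vector is sought in the span of the u_i, where the system has the invertible Gram matrix. -/
theorem exists_inner_eq {E ι : Type*} [NormedAddCommGroup E] [InnerProductSpace ℂ E] [Finite ι]
    {u : ι → E} (hu : LinearIndependent ℂ u) (y : ι → ℂ) : ∃ φ : E, ∀ i, inner ℂ (u i) φ = y i := by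
  classical
  cases nonempty_fintype ι
  have hdet := isUnit_iff_ne_zero.2 (Matrix.det_gram_ne_zero_iff_linearIndependent.2 hu)
  refine ⟨∑ j, ((Matrix.gram ℂ u)⁻¹.mulVec y) j • u j, fun i => ?_⟩
  have h : (Matrix.gram ℂ u).mulVec ((Matrix.gram ℂ u)⁻¹.mulVec y) i = y i := by
    rw [Matrix.mulVec_mulVec, Matrix.mul_nonsing_inv _ hdet, Matrix.one_mulVec]
  rw [← h, inner_sum, Matrix.mulVec, dotProduct]
  refine Finset.sum_congr rfl fun j _ => ?_
  rw [inner_smul_right, Matrix.gram_apply, mul_comm]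

section
variable {m n : ℕ} {α β : ℂ → ℂ}
  {v : OrthonormalBasis (Fin m) ℂ (modelSpace α)} {w : OrthonormalBasis (Fin n) ℂ (modelSpace β)}
  {B : Fin m → C(UnitAddCircle, ℂ)} {D : Fin n → C(UnitAddCircle, ℂ)}
  {N : Fin m → ℝ} {M : Fin n → ℝ}

theorem toMatrix_apply_eq_inner (A : modelSpace α →ₗ[ℂ] modelSpace β) (s : Fin n) (p : Fin m) :
    LinearMap.toMatrix v.toBasis w.toBasis A s p = inner ℂ (w s) (A (v p)) := by
  rw [LinearMap.toMatrix_apply, OrthonormalBasis.coe_toBasis,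
    OrthonormalBasis.coe_toBasis_repr_apply, OrthonormalBasis.repr_apply_apply]

theorem inner_projection_mul
    (hw : ∀ s, ((w s : modelSpace β) : L2Circle) = (M s : ℂ)⁻¹ • contL2 (D s))
    {φ f : L2Circle} {u : C(UnitAddCircle, ℂ)} (hf : f = contL2 u)
    (h : MemLp (fun t : UnitAddCircle => φ t * f t) 2 haarAddCircle) (s : Fin n) :
    inner ℂ (w s) ((modelSpace β).orthogonalProjectionOnto (h.toLp _)) =
      (M s : ℂ)⁻¹ * circlePairing φ (u * star (D s)) := by
  rw [Submodule.inner_orthogonalProjectionOnto_eq_of_mem_left, hw, inner_smul_left, map_inv₀,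
    Complex.conj_ofReal, inner_contL2, circlePairing]
  congr 1
  refine integral_congr_ae ?_
  have hu := coeFn_contL2 u
  rw [← hf] at hu
  filter_upwards [hu, h.coeFn_toLp] with t h1 h2
  rw [h2, h1]
  simp only [ContinuousMap.mul_apply, ContinuousMap.star_apply, RCLike.star_def]
  ring

/-- The Clark vectors have continuous representatives, so φ f ∈ L² for every f in K_α and the domain
condition on the symbol is harmless. Boundedness is automatic in finite dimension. -/
theorem mem_asymTruncToeplitz_iff
    (hv : ∀ p, ((v p : modelSpace α) : L2Circle) = (N p : ℂ)⁻¹ • contL2 (B p))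
    (hw : ∀ s, ((w s : modelSpace β) : L2Circle) = (M s : ℂ)⁻¹ • contL2 (D s))
    (A : modelSpace α →ₗ[ℂ] modelSpace β) :
    A ∈ asymTruncToeplitz α β ↔ ∃ φ : L2Circle, ∀ s p,
      LinearMap.toMatrix v.toBasis w.toBasis A s p =
        (N p : ℂ)⁻¹ * (M s : ℂ)⁻¹ * circlePairing φ (B p * star (D s)) := by
  constructor
  · rintro ⟨-, φ, hφ⟩
    refine ⟨φ, fun s p => ?_⟩
    have hp : ((v p : modelSpace α) : L2Circle) = contL2 ((N p : ℂ)⁻¹ • B p) := by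
      rw [hv, contL2, contL2, map_smul]
    have hmem : MemLp (fun t : UnitAddCircle => φ t * ((v p : modelSpace α) : L2Circle) t) 2
        haarAddCircle := by
      refine (memLp_contMul ((N p : ℂ)⁻¹ • B p) φ).ae_eq ?_
      rw [hp]
      filter_upwards [coeFn_contL2 ((N p : ℂ)⁻¹ • B p)] with t ht
      rw [ht, mul_comm]
    rw [toMatrix_apply_eq_inner, hφ _ hmem, inner_projection_mul hw hp]
    have h1 := circlePairing_sum φ (fun _ : Unit => (N p : ℂ)⁻¹) (fun _ => B p * star (D s))
    simp only [Finset.univ_unique, Finset.sum_const, Finset.card_singleton, one_smul] at h1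
    rw [smul_mul_assoc, h1]
    ring
  · rintro ⟨φ, hφ⟩
    have : FiniteDimensional ℂ (modelSpace α) := v.toBasis.finiteDimensional_of_finite
    refine ⟨A.continuous_of_finiteDimensional, φ, fun f h => ?_⟩
    have hf : (f : L2Circle) = contL2 (∑ p, (v.repr f p * (N p : ℂ)⁻¹) • B p) := by
      conv_lhs => rw [← v.sum_repr f]
      rw [Submodule.coe_sum, contL2, map_sum]
      refine Finset.sum_congr rfl fun p _ => ?_
      rw [Submodule.coe_smul, hv, map_smul, smul_smul]
    apply w.repr.injective
    ext s
    rw [OrthonormalBasis.repr_apply_apply, OrthonormalBasis.repr_apply_apply,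
      inner_projection_mul hw hf h, Finset.sum_mul]
    simp_rw [smul_mul_assoc]
    rw [circlePairing_sum, Finset.mul_sum]
    conv_lhs => rw [← v.sum_repr f, map_sum, inner_sum]
    refine Finset.sum_congr rfl fun p _ => ?_
    rw [map_smul, Submodule.coe_inner, Submodule.coe_smul, inner_smul_right,
      ← Submodule.coe_inner, ← toMatrix_apply_eq_inner, hφ]
    ring

end

/-! ### Relations between kernel products, and independence of the products indexed by E. -/

section
variable {m n l : ℕ} {η : Fin m → ℂ} {ζ : Fin n → ℂ}
  {B : Fin m → C(UnitAddCircle, ℂ)} {D : Fin n → C(UnitAddCircle, ℂ)}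
  {x y : UnitAddCircle → ℂ}

theorem kernel_mul_star_eq (hζ : ∀ s, ‖ζ s‖ = 1)
    (hB : ∀ p t, B p t * (η p - circlePt t) = η p * x t)
    (hD : ∀ s t, D s t * (ζ s - circlePt t) = ζ s * y t) {t : UnitAddCircle}
    (hη' : circlePt t ∉ Set.range η) (hζ' : circlePt t ∉ Set.range ζ) (s : Fin n) (p : Fin m) :
    (B p * star (D s)) t = η p * (circlePt t * x t * conj (y t)) /
      ((η p - circlePt t) * (circlePt t - ζ s)) := by
  have h1 : η p - circlePt t ≠ 0 := fun h => hη' ⟨p, sub_eq_zero.1 h⟩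
  have h2 : circlePt t - ζ s ≠ 0 := fun h => hζ' ⟨s, (sub_eq_zero.1 h).symm⟩
  have h3 := congrArg conj (hD s t)
  have h4 : conj (ζ s) * ζ s = 1 := by rw [Complex.conj_mul', hζ]; simp
  have h5 := conj_mul_circlePt t
  simp only [map_mul, map_sub] at h3
  have h6 : conj (D s t) * (circlePt t - ζ s) = circlePt t * conj (y t) := by
    linear_combination ζ s * circlePt t * h3 + conj (D s t) * ζ s * h5 +
      (circlePt t * conj (y t) - conj (D s t) * circlePt t) * h4
  rw [eq_div_iff (mul_ne_zero h1 h2)]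
  simp only [ContinuousMap.mul_apply, ContinuousMap.star_apply, RCLike.star_def]
  linear_combination conj (D s t) * (circlePt t - ζ s) * hB p t + η p * x t * h6

/-- The partial fraction identity behind all the relations; it holds pointwise for the products and
is then integrated against φ. -/
theorem circlePairing_rowCol (hη : ∀ p, ‖η p‖ = 1) (hζ : ∀ s, ‖ζ s‖ = 1)
    (hB : ∀ p t, B p t * (η p - circlePt t) = η p * x t)
    (hD : ∀ s t, D s t * (ζ s - circlePt t) = ζ s * y t) (φ : L2Circle)
    {s s' : Fin n} {p p' : Fin m} (hps : η p ≠ ζ s) :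
    circlePairing φ (B p * star (D s)) =
      η p / η p' * ((η p' - ζ s) / (η p - ζ s)) * circlePairing φ (B p' * star (D s)) +
      η p / η p' * ((ζ s' - η p') / (η p - ζ s)) * circlePairing φ (B p' * star (D s')) +
      (η p - ζ s') / (η p - ζ s) * circlePairing φ (B p * star (D s')) := by
  refine circlePairing_congr φ ?_
  filter_upwards [ae_circlePt_notMem (Set.finite_range η),
    ae_circlePt_notMem (Set.finite_range ζ)] with t h1 h2
  simp only [kernel_mul_star_eq hζ hB hD h1 h2]
  have e1 : ∀ q, η q - circlePt t ≠ 0 := fun q h => h1 ⟨q, sub_eq_zero.1 h⟩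
  have e2 : ∀ r, circlePt t - ζ r ≠ 0 := fun r h => h2 ⟨r, (sub_eq_zero.1 h).symm⟩
  have e3 : ∀ q, η q ≠ 0 := fun q => norm_ne_zero_iff.1 (by rw [hη]; exact one_ne_zero)
  have e4 := e1 p
  have e5 := e1 p'
  have e6 := e2 s
  have e7 := e2 s'
  have e8 := e3 p'
  have e9 : η p - ζ s ≠ 0 := sub_ne_zero.2 hps
  field_simp
  ring

theorem circlePairing_shared (hη : ∀ p, ‖η p‖ = 1) (hζ : ∀ s, ‖ζ s‖ = 1)
    (hB : ∀ p t, B p t * (η p - circlePt t) = η p * x t)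
    (hD : ∀ s t, D s t * (ζ s - circlePt t) = ζ s * y t) (φ : L2Circle)
    {s s' : Fin n} {p p' : Fin m} (hps : η p ≠ ζ s) (hs : η p' = ζ s) :
    circlePairing φ (B p * star (D s)) =
      η p / η p' * ((ζ s' - ζ s) / (η p - ζ s)) * circlePairing φ (B p' * star (D s')) +
      (η p - ζ s') / (η p - ζ s) * circlePairing φ (B p * star (D s')) := by
  rw [circlePairing_rowCol hη hζ hB hD φ (s' := s') (p' := p') hps, hs, sub_self]
  ring

/-- The first l points already exhaust the l common ones, so injectivity forces any coincidence to
be one of those listed. -/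
theorem eq_and_lt_of_shared {hlm : l ≤ m} {hln : l ≤ n} (hη : Function.Injective η)
    (hζ : Function.Injective ζ)
    (hshared : ∀ j : Fin l, η (Fin.castLE hlm j) = ζ (Fin.castLE hln j))
    (hcard : (Set.range η ∩ Set.range ζ).ncard = l) {p : Fin m} {s : Fin n} (h : η p = ζ s) :
    (s : ℕ) = p ∧ (s : ℕ) < l := by
  have hsub : Set.range (fun j : Fin l => η (Fin.castLE hlm j)) ⊆ Set.range η ∩ Set.range ζ := by
    rintro _ ⟨j, rfl⟩
    exact ⟨⟨_, rfl⟩, ⟨_, (hshared j).symm⟩⟩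
  have hinj : Function.Injective (fun j : Fin l => η (Fin.castLE hlm j)) :=
    hη.comp (Fin.castLE_injective hlm)
  have hc : (Set.range fun j : Fin l => η (Fin.castLE hlm j)).ncard = l := by
    rw [← Set.image_univ, Set.ncard_image_of_injective _ hinj, Set.ncard_univ, Nat.card_fin]
  have heq := Set.eq_of_subset_of_ncard_le hsub (by rw [hc, hcard])
    ((Set.finite_range η).inter_of_left _)
  have hmem : η p ∈ Set.range η ∩ Set.range ζ := ⟨⟨p, rfl⟩, ⟨s, h.symm⟩⟩
  rw [← heq] at hmem
  obtain ⟨j, hj⟩ := hmem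
  have h1 := hη hj
  have h2 := hζ (((hshared j).symm.trans hj).trans h)
  rw [← h1, ← h2]
  simp

/-- The column of the determining entry in the row `s ≠ 0`. -/
def determiningColumn [NeZero m] (hlm : l ≤ m) (s : Fin n) : Fin m :=
  if h : (s : ℕ) < l then ⟨s, h.trans_le hlm⟩ else 0

/-- Treats l = 0 and l > 0 at once: E is the first row together with a single entry in each other
row. -/
theorem mem_determiningEntries_iff [NeZero m] [NeZero n] (hlm : l ≤ m) (s : Fin n) (p : Fin m) :
    (s, p) ∈ determiningEntries n m l ↔ s = 0 ∨ p = determiningColumn hlm s := by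
  simp only [determiningEntries, determiningColumn, Set.mem_ofPred_eq, Fin.ext_iff, Fin.val_zero]
  split_ifs with h
  · simp only; omega
  · simp only [Fin.val_zero]; omega

theorem ncard_determiningEntries [NeZero m] [NeZero n] (hlm : l ≤ m) :
    (determiningEntries n m l).ncard = m + n - 1 := by
  have h : determiningEntries n m l = Set.range (fun p : Fin m => ((0 : Fin n), p)) ∪
      (fun s : Fin n => (s, determiningColumn hlm s)) '' {0}ᶜ := by
    ext ⟨s, p⟩
    rw [mem_determiningEntries_iff hlm]
    simp only [Set.mem_union, Set.mem_range, Prod.mk.injEq, Set.mem_image, Set.mem_compl_iff,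
      Set.mem_singleton_iff]
    by_cases hs : s = 0
    · simp [hs]
    · constructor
      · rintro (h | h)
        · exact absurd h hs
        · exact Or.inr ⟨s, hs, rfl, h.symm⟩
      · rintro (⟨q, h, -⟩ | ⟨r, -, rfl, rfl⟩)
        · exact absurd h.symm hs
        · exact Or.inr rfl
  have hdisj : Disjoint (Set.range (fun p : Fin m => ((0 : Fin n), p)))
      ((fun s : Fin n => (s, determiningColumn hlm s)) '' {0}ᶜ) := by
    rw [Set.disjoint_left]
    rintro _ ⟨p, rfl⟩ ⟨s, hs, h⟩
    exact hs (congrArg Prod.fst h)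
  rw [h, Set.ncard_union_eq hdisj (Set.toFinite _) (Set.toFinite _),
    Set.ncard_image_of_injective _ fun s s' h => congrArg Prod.fst h, ← Set.image_univ,
    Set.ncard_image_of_injective _ fun p p' h => congrArg Prod.snd h, Set.ncard_univ,
    Nat.card_fin, Set.ncard_compl, Nat.card_fin, Set.ncard_singleton]
  have := NeZero.pos n
  omega

/-- The sum is continuous, so it vanishes everywhere; at η_p only the p-th kernel survives. -/
theorem eq_zero_of_sum_kernel_eq_zero (hη : ∀ p, ‖η p‖ = 1) (hinj : Function.Injective η)
    (hB : ∀ p t, B p t = 0 ↔ ∃ q, q ≠ p ∧ circlePt t = η q) {c : Fin m → ℂ}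
    (h : ∀ᵐ t ∂(haarAddCircle : Measure UnitAddCircle), ∑ p, c p * B p t = 0) : c = 0 := by
  have h0 : contL2 (∑ p, c p • B p) = contL2 0 := by
    apply Lp.ext
    filter_upwards [h, coeFn_contL2 (∑ p, c p • B p), coeFn_contL2 0] with t h1 h2 h3
    rw [h2, h3, ContinuousMap.sum_apply]
    simpa using h1
  have h1 := ContinuousMap.toLp_injective (haarAddCircle : Measure UnitAddCircle) h0
  funext p
  obtain ⟨t, ht⟩ := exists_circlePt_eq (hη p)
  have h2 := congrArg (fun u : C(UnitAddCircle, ℂ) => u t) h1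
  simp only [ContinuousMap.sum_apply, ContinuousMap.smul_apply, smul_eq_mul,
    ContinuousMap.zero_apply] at h2
  rw [Finset.sum_eq_single p (fun q _ hq => by rw [(hB q t).2 ⟨p, hq.symm, ht⟩, mul_zero])
    (by simp)] at h2
  refine (mul_eq_zero.1 h2).resolve_right fun h3 => ?_
  obtain ⟨q, hq, hq'⟩ := (hB p t).1 h3
  exact hq (hinj (hq'.symm.trans ht))

/-- At ζ_s only row s survives, and for s ≠ 0 that row has one entry in E. The remaining first row
is conj(D_0) times a combination of the independent kernels B_p. -/
theorem coeff_eq_zero_of_sum_eq_zero [NeZero m] [NeZero n] {hlm : l ≤ m}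
    (hη : ∀ p, ‖η p‖ = 1) (hinj : Function.Injective η) (hζ : ∀ s, ‖ζ s‖ = 1)
    (hinjζ : Function.Injective ζ)
    (hmeet : ∀ p s, η p = ζ s → (s : ℕ) = p ∧ (s : ℕ) < l)
    (hB : ∀ p t, B p t = 0 ↔ ∃ q, q ≠ p ∧ circlePt t = η q)
    (hD : ∀ s t, D s t = 0 ↔ ∃ r, r ≠ s ∧ circlePt t = ζ r) {d : Fin n → Fin m → ℂ}
    (hd : ∀ s p, (s, p) ∉ determiningEntries n m l → d s p = 0)
    (h : ∀ t, ∑ s, ∑ p, d s p * (B p t * conj (D s t)) = 0) (s : Fin n) (p : Fin m) :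
    d s p = 0 := by
  have hrow : ∀ s, s ≠ 0 → ∀ p, d s p = 0 := by
    intro s hs p
    by_cases hp : p = determiningColumn hlm s
    swap
    · exact hd s p fun hmem => ((mem_determiningEntries_iff hlm s p).1 hmem).elim hs hp
    obtain ⟨t, ht⟩ := exists_circlePt_eq (hζ s)
    have h1 := h t
    rw [Finset.sum_eq_single s (fun r _ hr => by simp [(hD r t).2 ⟨s, hr.symm, ht⟩]) (by simp),
      Finset.sum_eq_single p (fun q _ hq => by
        rw [hd s q fun hmem => ((mem_determiningEntries_iff hlm s q).1 hmem).elim hs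
          fun h2 => hq (h2.trans hp.symm), zero_mul]) (by simp)] at h1
    refine (mul_eq_zero.1 h1).resolve_right (mul_ne_zero ?_ ?_)
    · rw [Ne, hB]
      rintro ⟨q, hq, hq'⟩
      -- B_p could vanish at ζ_s only if ζ_s = η_q with q ≠ p. But then q = s < l, so q is the
      -- determining column p: this is why E uses diagonal entries for common points.
      obtain ⟨h3, h4⟩ := hmeet q s (hq'.symm.trans ht)
      apply hq
      rw [hp, determiningColumn, dif_pos h4]
      exact Fin.ext h3.symm
    · rw [Ne, map_eq_zero, hD]
      rintro ⟨r, hr, hr'⟩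
      exact hr (hinjζ (hr'.symm.trans ht))
  by_cases hs : s = 0
  swap
  · exact hrow s hs p
  subst hs
  refine congrFun (eq_zero_of_sum_kernel_eq_zero hη hinj hB (c := d 0) ?_) p
  filter_upwards [ae_circlePt_notMem (Set.finite_range ζ)] with t ht
  have h1 := h t
  rw [Finset.sum_eq_single 0 (fun s _ hs => Finset.sum_eq_zero fun p _ => by
    rw [hrow s hs p, zero_mul]) (by simp)] at h1
  simp_rw [← mul_assoc] at h1
  rw [← Finset.sum_mul] at h1
  refine (mul_eq_zero.1 h1).resolve_right ?_
  rw [map_eq_zero, hD]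
  rintro ⟨r, -, hr⟩
  exact ht ⟨r, hr.symm⟩

theorem exists_circlePairing_eq [NeZero m] [NeZero n] {hlm : l ≤ m}
    (hη : ∀ p, ‖η p‖ = 1) (hinj : Function.Injective η) (hζ : ∀ s, ‖ζ s‖ = 1)
    (hinjζ : Function.Injective ζ)
    (hmeet : ∀ p s, η p = ζ s → (s : ℕ) = p ∧ (s : ℕ) < l)
    (hB : ∀ p t, B p t = 0 ↔ ∃ q, q ≠ p ∧ circlePt t = η q)
    (hD : ∀ s t, D s t = 0 ↔ ∃ r, r ≠ s ∧ circlePt t = ζ r) (z : Fin n → Fin m → ℂ) :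
    ∃ φ : L2Circle, ∀ s p, (s, p) ∈ determiningEntries n m l →
      circlePairing φ (B p * star (D s)) = z s p := by
  classical
  have hli : LinearIndependent ℂ fun e : determiningEntries n m l =>
      contL2 (star (B e.1.2 * star (D e.1.1))) := by
    rw [Fintype.linearIndependent_iff]
    intro c hc e
    have h0 : contL2 (∑ e : determiningEntries n m l,
        c e • star (B e.1.2 * star (D e.1.1))) = contL2 0 := by
      simpa only [contL2, map_sum, map_smul, map_zero] using hc
    have h1 := ContinuousMap.toLp_injective (haarAddCircle : Measure UnitAddCircle) h0
    -- The family consists of conjugated products, so the relation is conjugated, and its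
    -- coefficients are extended by zero off E.
    let d : Fin n → Fin m → ℂ := fun s p =>
      if h : (s, p) ∈ determiningEntries n m l then conj (c ⟨(s, p), h⟩) else 0
    have hd := coeff_eq_zero_of_sum_eq_zero (hlm := hlm) (d := d) hη hinj hζ hinjζ hmeet hB hD
      (fun s p h => dif_neg h) (fun t => by
        have h2 := congrArg (fun u : C(UnitAddCircle, ℂ) => conj (u t)) h1
        simp only [ContinuousMap.sum_apply, ContinuousMap.smul_apply, smul_eq_mul,
          ContinuousMap.zero_apply, map_sum, map_zero, ContinuousMap.star_apply,
          ContinuousMap.mul_apply, map_mul, RCLike.star_def, Complex.conj_conj] at h2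
        rw [← Fintype.sum_prod_type', ← h2,
          ← Finset.sum_subset (Finset.subset_univ (determiningEntries n m l).toFinset)
            (fun x _ hx => by rw [show d x.1 x.2 = 0 from dif_neg (by simpa using hx), zero_mul]),
          ← Finset.sum_set_coe]
        refine Finset.sum_congr rfl fun x _ => ?_
        rw [show d x.1.1 x.1.2 = conj (c x) from dif_pos x.2]) e.1.1 e.1.2
    simpa [d] using hd
  obtain ⟨φ, hφ⟩ := exists_inner_eq hli fun e => z e.1.1 e.1.2
  exact ⟨φ, fun s p h => by rw [← inner_contL2_star]; exact hφ ⟨(s, p), h⟩⟩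

end
end

/-! ### The Clark relations characterize the operators, and the main theorem. -/

noncomputable section

open AddCircle Metric ComplexConjugate

theorem eq_smul_contL2 {f : L2Circle} {k : ℂ} {u : C(UnitAddCircle, ℂ)}
    (h : (f : UnitAddCircle → ℂ) =ᵐ[haarAddCircle] fun t => k * u t) : f = k • contL2 u := by
  apply Lp.ext
  filter_upwards [h, Lp.coeFn_smul k (contL2 u), coeFn_contL2 u] with t h1 h2 h3
  rw [h1, h2, Pi.smul_apply, h3, smul_eq_mul]

section
variable {m n l : ℕ} [NeZero m] [NeZero n] {hlm : l ≤ m} {hln : l ≤ n}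
  {η : Fin m → ℂ} {ζ : Fin n → ℂ} {N : Fin m → ℝ} {M : Fin n → ℝ}

/-- The linear relations between the matrix entries of an asymmetric truncated Toeplitz operator
with respect to Clark bases, for kernels of norms `N p` and `M s`. -/
def ClarkRelations (hlm : l ≤ m) (hln : l ≤ n) (N : Fin m → ℝ) (M : Fin n → ℝ)
    (η : Fin m → ℂ) (ζ : Fin n → ℂ) (r : Matrix (Fin n) (Fin m) ℂ) : Prop :=
  (l = 0 → ∀ (p : Fin m) (s : Fin n),
    r s p = (N 0 / N p : ℝ) * (η p / η 0) * ((η 0 - ζ s) / (η p - ζ s)) * r s 0 +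
      (N 0 * M 0 / (N p * M s) : ℝ) * (η p / η 0) * ((ζ 0 - η 0) / (η p - ζ s)) * r 0 0 +
      (M 0 / M s : ℝ) * ((η p - ζ 0) / (η p - ζ s)) * r 0 p) ∧
  (0 < l →
    (∀ (p : Fin m) (j : Fin l), Fin.castLE hlm j ≠ p →
      r (Fin.castLE hln j) p =
        (N (Fin.castLE hlm j) * M 0 / (N p * M (Fin.castLE hln j)) : ℝ) *
            (η p / η (Fin.castLE hlm j)) *
            ((η 0 - ζ (Fin.castLE hln j)) / (η p - ζ (Fin.castLE hln j))) *
            r 0 (Fin.castLE hlm j) +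
          (M 0 / M (Fin.castLE hln j) : ℝ) *
            ((η p - ζ 0) / (η p - ζ (Fin.castLE hln j))) * r 0 p) ∧
    (∀ (p : Fin m) (s : Fin n), l ≤ (s : ℕ) →
      r s p = (N 0 / N p : ℝ) * (η p / η 0) * ((η 0 - ζ s) / (η p - ζ s)) * r s 0 +
        (M 0 / M s : ℝ) * ((η p - ζ 0) / (η p - ζ s)) * r 0 p))

theorem ClarkRelations.eq_of_eqOn {r r' : Matrix (Fin n) (Fin m) ℂ}
    (hr : ClarkRelations hlm hln N M η ζ r) (hr' : ClarkRelations hlm hln N M η ζ r')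
    (h : ∀ s p, (s, p) ∈ determiningEntries n m l → r s p = r' s p) : r = r' := by
  have hrow : ∀ p, r 0 p = r' 0 p := fun p =>
    h 0 p ((mem_determiningEntries_iff hlm 0 p).2 (Or.inl rfl))
  have hcol : ∀ s, r s (determiningColumn hlm s) = r' s (determiningColumn hlm s) := fun s =>
    h s _ ((mem_determiningEntries_iff hlm s _).2 (Or.inr rfl))
  have hcol0 : ∀ s : Fin n, l ≤ (s : ℕ) → r s 0 = r' s 0 := fun s hs => by
    have := hcol s
    rwa [determiningColumn, dif_neg (not_lt.2 hs)] at this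
  ext s p
  rcases Nat.eq_zero_or_pos l with hl | hl
  · rw [hr.1 hl, hr'.1 hl, hrow, hrow, hcol0 s (hl ▸ Nat.zero_le _)]
  · rcases lt_or_ge (s : ℕ) l with hs | hs
    · by_cases hp : Fin.castLE hlm ⟨s, hs⟩ = p
      · have := hcol s
        rw [determiningColumn, dif_pos hs] at this
        rw [← hp]
        exact this
      · have e1 := (hr.2 hl).1 p ⟨s, hs⟩ hp
        have e2 := (hr'.2 hl).1 p ⟨s, hs⟩ hp
        rw [hrow, hrow] at e1
        exact e1.trans e2.symm
    · rw [(hr.2 hl).2 p s hs, (hr'.2 hl).2 p s hs, hrow, hcol0 s hs]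

theorem clarkRelations_of_circlePairing {B : Fin m → C(UnitAddCircle, ℂ)}
    {D : Fin n → C(UnitAddCircle, ℂ)} {x y : UnitAddCircle → ℂ} (hN : ∀ p, 0 < N p)
    (hM : ∀ s, 0 < M s) (hη : ∀ p, ‖η p‖ = 1) (hζ : ∀ s, ‖ζ s‖ = 1)
    (hinj : Function.Injective η)
    (hshared : ∀ j : Fin l, η (Fin.castLE hlm j) = ζ (Fin.castLE hln j))
    (hmeet : ∀ p s, η p = ζ s → (s : ℕ) = p ∧ (s : ℕ) < l)
    (hB : ∀ p t, B p t * (η p - circlePt t) = η p * x t)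
    (hD : ∀ s t, D s t * (ζ s - circlePt t) = ζ s * y t) {φ : L2Circle}
    {r : Matrix (Fin n) (Fin m) ℂ}
    (hr : ∀ s p, r s p = (N p : ℂ)⁻¹ * (M s : ℂ)⁻¹ * circlePairing φ (B p * star (D s))) :
    ClarkRelations hlm hln N M η ζ r := by
  have hN0 : ∀ p, (N p : ℂ) ≠ 0 := fun p => by exact_mod_cast (hN p).ne'
  have hM0 : ∀ s, (M s : ℂ) ≠ 0 := fun s => by exact_mod_cast (hM s).ne'
  have hrowCol : ∀ p s, η p ≠ ζ s →
      r s p = (N 0 / N p : ℝ) * (η p / η 0) * ((η 0 - ζ s) / (η p - ζ s)) * r s 0 +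
      (N 0 * M 0 / (N p * M s) : ℝ) * (η p / η 0) * ((ζ 0 - η 0) / (η p - ζ s)) * r 0 0 +
      (M 0 / M s : ℝ) * ((η p - ζ 0) / (η p - ζ s)) * r 0 p := by
    intro p s hps
    simp only [hr]
    rw [circlePairing_rowCol hη hζ hB hD φ (s' := 0) (p' := 0) hps]
    push_cast
    have h1 := hN0 0
    have h2 := hN0 p
    have h3 := hM0 0
    have h4 := hM0 s
    -- With the geometric factors frozen, only the norms remain to be cleared.
    generalize (η p / η 0) = k₀
    generalize ((η 0 - ζ s) / (η p - ζ s)) = k₁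
    generalize ((ζ 0 - η 0) / (η p - ζ s)) = k₂
    generalize ((η p - ζ 0) / (η p - ζ s)) = k₃
    field_simp
  refine ⟨fun hl p s => hrowCol p s fun h => ?_, fun hl => ⟨fun p j hj => ?_, fun p s hs => ?_⟩⟩
  · have := (hmeet p s h).2
    omega
  · have hps : η p ≠ ζ (Fin.castLE hln j) := by
      rw [← hshared]
      exact fun h => hj (hinj h).symm
    have h0 : η 0 = ζ 0 := hshared ⟨0, hl⟩
    simp only [hr]
    rw [circlePairing_shared hη hζ hB hD φ (s' := 0) hps (hshared j), h0]
    push_cast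
    have h1 := hN0 (Fin.castLE hlm j)
    have h2 := hN0 p
    have h3 := hM0 0
    have h4 := hM0 (Fin.castLE hln j)
    generalize (η p / η (Fin.castLE hlm j)) = k₀
    generalize ((ζ 0 - ζ (Fin.castLE hln j)) / (η p - ζ (Fin.castLE hln j))) = k₁
    generalize ((η p - ζ 0) / (η p - ζ (Fin.castLE hln j))) = k₂
    field_simp
  · have h0 : η 0 = ζ 0 := hshared ⟨0, hl⟩
    have h := hrowCol p s fun h => (hmeet p s h).2.not_ge hs
    -- As η_0 = ζ_0, the coefficient of the corner entry is zero.
    rw [h, h0]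
    ring

end
end

theorem theorem3p4 {m n l : ℕ} [NeZero m] [NeZero n] (α β : ℂ → ℂ)
    (hα : IsFiniteBlaschkeProduct m α) (hβ : IsFiniteBlaschkeProduct n β)
    (lam₁ lam₂ : ℂ) (hlam₁ : ‖lam₁‖ = 1) (hlam₂ : ‖lam₂‖ = 1)
    (η : Fin m → ℂ) (ζ : Fin n → ℂ)
    (hη : IsClarkPoints α lam₁ η) (hζ : IsClarkPoints β lam₂ ζ)
    (hlm : l ≤ m) (hln : l ≤ n)
    (hshared : ∀ j : Fin l, η (Fin.castLE hlm j) = ζ (Fin.castLE hln j))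
    (hcard : (Set.range η ∩ Set.range ζ).ncard = l) :
    ∃ (v : OrthonormalBasis (Fin m) ℂ (modelSpace α))
      (w : OrthonormalBasis (Fin n) ℂ (modelSpace β)),
      IsClarkBasis α η v ∧ IsClarkBasis β ζ w ∧
      (∀ (A : modelSpace α →ₗ[ℂ] modelSpace β) (r : Matrix (Fin n) (Fin m) ℂ),
        r = LinearMap.toMatrix v.toBasis w.toBasis A →
        (l = 0 →
          (A ∈ asymTruncToeplitz α β ↔
            ∀ (p : Fin m) (s : Fin n),
              r s p =
                (√‖deriv α (η 0)‖ / √‖deriv α (η p)‖ : ℝ) * (η p / η 0) *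
                    ((η 0 - ζ s) / (η p - ζ s)) * r s 0 +
                  (√‖deriv α (η 0)‖ * √‖deriv β (ζ 0)‖ /
                      (√‖deriv α (η p)‖ * √‖deriv β (ζ s)‖) : ℝ) * (η p / η 0) *
                    ((ζ 0 - η 0) / (η p - ζ s)) * r 0 0 +
                  (√‖deriv β (ζ 0)‖ / √‖deriv β (ζ s)‖ : ℝ) *
                    ((η p - ζ 0) / (η p - ζ s)) * r 0 p)) ∧
        (0 < l →
          (A ∈ asymTruncToeplitz α β ↔
            (∀ (p : Fin m) (j : Fin l), Fin.castLE hlm j ≠ p →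
              r (Fin.castLE hln j) p =
                (√‖deriv α (η (Fin.castLE hlm j))‖ * √‖deriv β (ζ 0)‖ /
                      (√‖deriv α (η p)‖ * √‖deriv β (ζ (Fin.castLE hln j))‖) : ℝ) *
                    (η p / η (Fin.castLE hlm j)) *
                    ((η 0 - ζ (Fin.castLE hln j)) / (η p - ζ (Fin.castLE hln j))) *
                    r 0 (Fin.castLE hlm j) +
                  (√‖deriv β (ζ 0)‖ / √‖deriv β (ζ (Fin.castLE hln j))‖ : ℝ) *
                    ((η p - ζ 0) / (η p - ζ (Fin.castLE hln j))) * r 0 p) ∧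
            (∀ (p : Fin m) (s : Fin n), l ≤ (s : ℕ) →
              r s p =
                (√‖deriv α (η 0)‖ / √‖deriv α (η p)‖ : ℝ) * (η p / η 0) *
                    ((η 0 - ζ s) / (η p - ζ s)) * r s 0 +
                  (√‖deriv β (ζ 0)‖ / √‖deriv β (ζ s)‖ : ℝ) *
                    ((η p - ζ 0) / (η p - ζ s)) * r 0 p)))) ∧
      (determiningEntries n m l).ncard = m + n - 1 ∧
      (∀ x : Fin n → Fin m → ℂ, ∃! A : modelSpace α →ₗ[ℂ] modelSpace β,
        A ∈ asymTruncToeplitz α β ∧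
          ∀ e ∈ determiningEntries n m l,
            LinearMap.toMatrix v.toBasis w.toBasis A e.1 e.2 = x e.1 e.2) := by
  obtain ⟨v, B, x, hvb, hN, hvc, hB, hBx⟩ := exists_clarkBasis hα hη
  obtain ⟨w, D, y, hwb, hM, hwc, hD, hDy⟩ := exists_clarkBasis hβ hζ
  set N : Fin m → ℝ := fun p => √‖deriv α (η p)‖
  set M : Fin n → ℝ := fun s => √‖deriv β (ζ s)‖
  have hv : ∀ p, ((v p : modelSpace α) : L2Circle) = (N p : ℂ)⁻¹ • contL2 (B p) :=
    fun p => eq_smul_contL2 (hvc p)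
  have hw : ∀ s, ((w s : modelSpace β) : L2Circle) = (M s : ℂ)⁻¹ • contL2 (D s) :=
    fun s => eq_smul_contL2 (hwc s)
  have hη1 : ∀ p, ‖η p‖ = 1 := fun p => (hη.2 p).1
  have hζ1 : ∀ s, ‖ζ s‖ = 1 := fun s => (hζ.2 s).1
  have hmeet : ∀ p s, η p = ζ s → (s : ℕ) = p ∧ (s : ℕ) < l :=
    fun p s => eq_and_lt_of_shared hη.1 hζ.1 hshared hcard
  have hrel : ∀ A : modelSpace α →ₗ[ℂ] modelSpace β, A ∈ asymTruncToeplitz α β →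
      ClarkRelations hlm hln N M η ζ (LinearMap.toMatrix v.toBasis w.toBasis A) := by
    intro A hA
    obtain ⟨φ, hφ⟩ := (mem_asymTruncToeplitz_iff hv hw A).1 hA
    exact clarkRelations_of_circlePairing hN hM hη1 hζ1 hη.1 hshared hmeet hBx hDy hφ
  have hex : ∀ z : Fin n → Fin m → ℂ, ∃ A : modelSpace α →ₗ[ℂ] modelSpace β,
      A ∈ asymTruncToeplitz α β ∧ ∀ s p, (s, p) ∈ determiningEntries n m l →
        LinearMap.toMatrix v.toBasis w.toBasis A s p = z s p := by
    intro z
    obtain ⟨φ, hφ⟩ := exists_circlePairing_eq (hlm := hlm) hη1 hη.1 hζ1 hζ.1 hmeet hB hD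
      -- The factors cancel the normalization of the basis vectors.
      fun s p => (N p : ℂ) * (M s : ℂ) * z s p
    refine ⟨Matrix.toLin v.toBasis w.toBasis (Matrix.of fun s p =>
      (N p : ℂ)⁻¹ * (M s : ℂ)⁻¹ * circlePairing φ (B p * star (D s))),
      (mem_asymTruncToeplitz_iff hv hw _).2 ⟨φ, fun s p => ?_⟩, fun s p hsp => ?_⟩
    · rw [LinearMap.toMatrix_toLin, Matrix.of_apply]
    · have h1 : (N p : ℂ) ≠ 0 := by exact_mod_cast (hN p).ne'
      have h2 : (M s : ℂ) ≠ 0 := by exact_mod_cast (hM s).ne'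
      rw [LinearMap.toMatrix_toLin, Matrix.of_apply, hφ s p hsp]
      field_simp
  have hiff : ∀ A : modelSpace α →ₗ[ℂ] modelSpace β, A ∈ asymTruncToeplitz α β ↔
      ClarkRelations hlm hln N M η ζ (LinearMap.toMatrix v.toBasis w.toBasis A) := by
    refine fun A => ⟨hrel A, fun hA => ?_⟩
    -- An operator with a symbol and the same entries on E; both matrices satisfy the relations, so
    -- it is A.
    obtain ⟨A', hA', h⟩ := hex (LinearMap.toMatrix v.toBasis w.toBasis A)
    have heq := (hrel A' hA').eq_of_eqOn hA h
    rwa [← (LinearMap.toMatrix v.toBasis w.toBasis).injective heq]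
  refine ⟨v, w, hvb, hwb, fun A r hr => ⟨fun hl => ?_, fun hl => ?_⟩,
    ncard_determiningEntries hlm, fun z => ?_⟩
  · rw [hiff A, ← hr]
    exact ⟨fun h => h.1 hl, fun h => ⟨fun _ => h, fun hl' => absurd hl hl'.ne'⟩⟩
  · rw [hiff A, ← hr]
    exact ⟨fun h => h.2 hl, fun h => ⟨fun hl' => absurd hl' hl.ne', fun _ => h⟩⟩
  · obtain ⟨A, hA, h⟩ := hex z
    refine ⟨A, ⟨hA, fun e he => h e.1 e.2 he⟩, fun A' hA' => ?_⟩
    refine (LinearMap.toMatrix v.toBasis w.toBasis).injective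
      ((hrel A' hA'.1).eq_of_eqOn (hrel A hA) fun s p hsp => ?_)
    rw [h s p hsp, hA'.2 (s, p) hsp]
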